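/- Let $(M,g)$ be a connected closed Riemannian manifold of dimension $d\ge 2$, let $T'M=T^*M\setminus\{0\}$, and let $h(x,\xi)=\left(g^{\alpha\beta}(x)\,\xi_\alpha\xi_\beta\right)^{1/2}$ (Einstein's summation convention is used throughout). Let $(x^*(t;y,\eta),\xi^*(t;y,\eta))$, $t\in\mathbb R$, $(y,\eta)\in T'M$, be the cogeodesic flow, i.e. the global solution of Hamilton's equations $\dot x^*=h_\xi(x^*,\xi^*)$, $\dot\xi^*=-h_x(x^*,\xi^*)$ with $(x^*,\xi^*)|_{t=0}=(y,\eta)$. Let $\epsilon>0$ and let $\varphi=\varphi(t,x;y,\eta;\epsilon)$ be the Levi-Civita phase function: an infinitely smooth complex-valued function on $\mathbb R\times M\times T'M$ with $\operatorname{Im}\varphi\ge 0$ which, for $x$ in a neighbourhood of $x^*=x^*(t;y,\eta)$, is given by $$\varphi(t,x;y,\eta;\epsilon)=\int_\gamma\zeta\,\mathrm dz+\frac{\mathrm i\,\epsilon}{2}\,h(y,\eta)\,\operatorname{dist}^2(x,x^*),$$ where $\gamma$ is the shortest geodesic from $x^*$ to $x$, $\zeta$ is the parallel transport of $\xi^*(t;y,\eta)$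 along $\gamma$, and $\operatorname{dist}$ is the Riemannian distance. Fix $t\in\mathbb R$ and $(y,\eta)\in T'M$. In arbitrary local coordinates $x$ near $x^*(t;y,\eta)$ and arbitrary local coordinates near $y$, with $\eta_\mu$ the induced coordinates on $T^*_yM$, put $$q^{\alpha\mu}=\frac{\partial (x^*)^\alpha}{\partial\eta_\mu},\qquad p^{\alpha\mu}=g^{\alpha\gamma}(x^*)\left[\frac{\partial\xi^*_\gamma}{\partial\eta_\mu}-\Gamma^\rho{}_{\gamma\beta}(x^*)\,\xi^*_\rho\,\frac{\partial (x^*)^\beta}{\partial\eta_\mu}\right],$$ where $\Gamma^\rho{}_{\gamma\beta}$ are the Christoffel symbols of $g$. Then all the derivatives involved exist, and $$\left.\varphi_{x^\alpha\eta_\mu}\right|_{x=x^*}=g_{\alpha\beta}(x^*)\left[p^{\beta\mu}-\mathrm i\,\epsilon\,h(y,\eta)\,q^{\beta\mu}\right]$$ for all $\alpha,\mu\in\{1,\dots,d\}$. -/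

import Mathlib

open Bundle Manifold Filter Topology Matrix
open scoped ContDiff

noncomputable section

namespace LeviCivitaPhase

/-- The model space `ℝ^d`. -/
abbrev Model (d : ℕ) : Type := EuclideanSpace ℝ (Fin d)

/-- The cotangent space `T*_x M`, as a fibre of Mathlib's bundle of continuous linear maps from
the tangent bundle to the trivial line bundle. -/
abbrev Cotangent (d : ℕ) {M : Type*} [TopologicalSpace M] [ChartedSpace (Model d) M]
    (x : M) : Type :=
  TangentSpace 𝓘(ℝ, Model d) x →L[ℝ] Bundle.Trivial M ℝ x

/-- The cotangent bundle `T*M`; a point is a pair `⟨x, ξ⟩` with `ξ` in `T*_x M`. -/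
abbrev CotangentBundle (d : ℕ) (M : Type*) [TopologicalSpace M] [ChartedSpace (Model d) M] :
    Type _ :=
  TotalSpace (Model d →L[ℝ] ℝ) (fun x : M => Cotangent d x)

section Coordinates

variable {d : ℕ} {M : Type*} [TopologicalSpace M] [ChartedSpace (Model d) M]

/-- The pairing of a covector and a tangent vector. -/
def pairing {x : M} (ξ : Cotangent d x) (v : TangentSpace 𝓘(ℝ, Model d) x) : ℝ := ξ v

/-- The partial derivative `∂f/∂u^α` of a function of the coordinates `u ∈ ℝ^d`. -/
def partialD {F : Type*} [NormedAddCommGroup F] [NormedSpace ℝ F]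
    (f : Model d → F) (α : Fin d) (u : Model d) : F :=
  lineDeriv ℝ f u (EuclideanSpace.single α 1)

/-- The coordinate vector `∂/∂x^α` at `x`, for the local coordinates given by the chart `e`. -/
def coordVec (e : OpenPartialHomeomorph M (Model d)) (x : M) (α : Fin d) :
    TangentSpace 𝓘(ℝ, Model d) x :=
  (mfderiv 𝓘(ℝ, Model d) 𝓘(ℝ, Model d) e x).inverse (EuclideanSpace.single α (1 : ℝ) : Model d)

/-- The coordinate covector `dx^μ` at `x`, for the local coordinates given by the chart `e`. -/
def coordCovec (e : OpenPartialHomeomorph M (Model d)) (x : M) (μ : Fin d) : Cotangent d x :=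
  (EuclideanSpace.proj μ : Model d →L[ℝ] ℝ).comp
    (mfderiv 𝓘(ℝ, Model d) 𝓘(ℝ, Model d) e x : TangentSpace 𝓘(ℝ, Model d) x →L[ℝ] Model d)

/-- The components `ξ_α` of the covector `ξ` at the point `x`, where `p = ⟨x, ξ⟩`. -/
def momCoord (e : OpenPartialHomeomorph M (Model d)) (p : CotangentBundle d M) (α : Fin d) : ℝ :=
  pairing p.2 (coordVec e p.proj α)

/-- The velocity `γ̇(s)` of a curve in `M`. -/
def velocity (γ : ℝ → M) (s : ℝ) : TangentSpace 𝓘(ℝ, Model d) (γ s) :=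
  mfderiv 𝓘(ℝ, ℝ) 𝓘(ℝ, Model d) γ s (1 : ℝ)

end Coordinates

section Riemannian

variable {d : ℕ} {M : Type*} [MetricSpace M] [ChartedSpace (Model d) M]
  [RiemannianBundle (fun x : M => TangentSpace 𝓘(ℝ, Model d) x)]

/-- The components `g_{αβ}` of the metric, as functions of the coordinates `u`. -/
def gLow (e : OpenPartialHomeomorph M (Model d)) (u : Model d) : Matrix (Fin d) (Fin d) ℝ :=
  Matrix.of fun α β => inner ℝ (coordVec e (e.symm u) α) (coordVec e (e.symm u) β)

/-- The components `g^{αβ}` of the inverse metric. -/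
def gUp (e : OpenPartialHomeomorph M (Model d)) (u : Model d) : Matrix (Fin d) (Fin d) ℝ :=
  (gLow e u)⁻¹

/-- The Christoffel symbols `Γ^ρ_{αβ} = ½ g^{ρσ} (∂_α g_{σβ} + ∂_β g_{σα} - ∂_σ g_{αβ})`. -/
def christoffel (e : OpenPartialHomeomorph M (Model d)) (u : Model d) (ρ α β : Fin d) : ℝ :=
  (1 / 2) * ∑ σ, gUp e u ρ σ *
    (partialD (fun v => gLow e v σ β) α u + partialD (fun v => gLow e v σ α) β u
      - partialD (fun v => gLow e v α β) σ u)

/-- The Hamiltonian `(g^{αβ}(u) ξ_α ξ_β)^{1/2}` in the coordinates given by `e`. -/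
def hamCoord (e : OpenPartialHomeomorph M (Model d)) (u ξ : Model d) : ℝ :=
  Real.sqrt (∑ α, ∑ β, gUp e u α β * ξ α * ξ β)

/-- The Hamiltonian `h(x, ξ) = (g^{αβ}(x) ξ_α ξ_β)^{1/2}` as a function on `T*M`. The value does
not depend on the coordinates; the preferred chart at `x` is used. -/
def ham (p : CotangentBundle d M) : ℝ :=
  hamCoord (chartAt (Model d) p.proj) (chartAt (Model d) p.proj p.proj)
    (WithLp.toLp 2 (momCoord (chartAt (Model d) p.proj) p))

/-- `c(t) = (x(t), ξ(t))` is a trajectory of Hamilton's equations `ẋ^α = ∂h/∂ξ_α`,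
`ξ̇_α = -∂h/∂x^α`: it is continuous, and the equations hold in all local coordinates. -/
def IsHamiltonTrajectory [IsManifold 𝓘(ℝ, Model d) ∞ M] (c : ℝ → CotangentBundle d M) : Prop :=
  Continuous c ∧
  ∀ e ∈ IsManifold.maximalAtlas 𝓘(ℝ, Model d) ∞ M, ∀ t : ℝ, (c t).proj ∈ e.source →
    ∀ α : Fin d,
      HasDerivAt (fun τ => e (c τ).proj α)
        (partialD (fun ξ => hamCoord e (e (c t).proj) ξ) α (WithLp.toLp 2 (momCoord e (c t)))) t ∧
      HasDerivAt (fun τ => momCoord e (c τ) α)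
        (-partialD (fun u => hamCoord e u (WithLp.toLp 2 (momCoord e (c t)))) α (e (c t).proj)) t

/-- `Φ t (y, η) = (x*(t; y, η), ξ*(t; y, η))` is the (co)geodesic flow on `T'M = T*M \ 0`: the
global solution of Hamilton's equations with `Φ 0 (y, η) = (y, η)`. Values of `Φ` on the zero
section are irrelevant. -/
def IsCogeodesicFlow [IsManifold 𝓘(ℝ, Model d) ∞ M]
    (Φ : ℝ → CotangentBundle d M → CotangentBundle d M) : Prop :=
  ∀ p : CotangentBundle d M, p.2 ≠ 0 → IsHamiltonTrajectory (fun t => Φ t p) ∧ Φ 0 p = p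

/-- `γ` is a geodesic: a smooth curve with `γ̈^ρ + Γ^ρ_{αβ}(γ) γ̇^α γ̇^β = 0` in all local
coordinates. Since geodesics on a closed manifold extend to the whole line, `γ` is defined
on `ℝ`. -/
def IsGeodesic (d : ℕ) {M : Type*} [MetricSpace M] [ChartedSpace (Model d) M]
    [RiemannianBundle (fun x : M => TangentSpace 𝓘(ℝ, Model d) x)]
    [IsManifold 𝓘(ℝ, Model d) ∞ M] (γ : ℝ → M) : Prop :=
  ContMDiff 𝓘(ℝ, ℝ) 𝓘(ℝ, Model d) ∞ γ ∧
  ∀ e ∈ IsManifold.maximalAtlas 𝓘(ℝ, Model d) ∞ M, ∀ s : ℝ, γ s ∈ e.source → ∀ ρ : Fin d,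
    deriv (deriv (fun τ => e (γ τ) ρ)) s
      + ∑ α, ∑ β, christoffel e (e (γ s)) ρ α β
          * deriv (fun τ => e (γ τ) α) s * deriv (fun τ => e (γ τ) β) s = 0

/-- `γ`, restricted to `[0, 1]`, is a shortest geodesic from `z` to `x`. -/
def IsShortestGeodesic (d : ℕ) {M : Type*} [MetricSpace M] [ChartedSpace (Model d) M]
    [RiemannianBundle (fun x : M => TangentSpace 𝓘(ℝ, Model d) x)]
    [IsManifold 𝓘(ℝ, Model d) ∞ M] (γ : ℝ → M) (z x : M) : Prop :=
  IsGeodesic d γ ∧ γ 0 = z ∧ γ 1 = x ∧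
    Manifold.pathELength 𝓘(ℝ, Model d) γ 0 1 = edist z x

/-- The covector field `c(s) = (γ(s), ζ(s))` along its base curve `γ` is parallel:
`ζ̇_β - Γ^ρ_{αβ}(γ) γ̇^α ζ_ρ = 0` in all local coordinates. -/
def IsParallelCovector [IsManifold 𝓘(ℝ, Model d) ∞ M] (c : ℝ → CotangentBundle d M) : Prop :=
  ∀ e ∈ IsManifold.maximalAtlas 𝓘(ℝ, Model d) ∞ M, ∀ s : ℝ, (c s).proj ∈ e.source →
    ∀ β : Fin d,
      HasDerivAt (fun τ => momCoord e (c τ) β)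
        (∑ α, ∑ ρ, christoffel e (e (c s).proj) ρ α β
          * deriv (fun τ => e (c τ).proj α) s * momCoord e (c s) ρ) s

/-- `φ(t, x; y, η)` is a Levi-Civita phase function with parameter `ε`, for the cogeodesic flow
`Φ`: it is smooth on `ℝ × M × T'M`, has `Im φ ≥ 0`, and for `x` near `x* = x*(t; y, η)` it equals
`∫_γ ζ dz + (i ε / 2) h(y, η) dist²(x, x*)`, where `γ` is the shortest geodesic from `x*` to `x`
and `ζ` is the parallel transport of `ξ*(t; y, η)` along `γ` (with `c = (γ, ζ)` below). -/
structure IsLeviCivitaPhase [IsManifold 𝓘(ℝ, Model d) ∞ M]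
    (Φ : ℝ → CotangentBundle d M → CotangentBundle d M) (ε : ℝ)
    (φ : ℝ → M → CotangentBundle d M → ℂ) : Prop where
  smooth : ContMDiffOn
    (𝓘(ℝ, ℝ).prod (𝓘(ℝ, Model d).prod (𝓘(ℝ, Model d).prod 𝓘(ℝ, Model d →L[ℝ] ℝ)))) 𝓘(ℝ, ℂ) ∞
    (fun r : ℝ × M × CotangentBundle d M => φ r.1 r.2.1 r.2.2) {r | r.2.2.2 ≠ 0}
  im_nonneg : ∀ (t : ℝ) (x : M) (p : CotangentBundle d M), p.2 ≠ 0 → 0 ≤ (φ t x p).im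
  eq_near : ∀ (t : ℝ) (p : CotangentBundle d M), p.2 ≠ 0 → ∀ᶠ x in 𝓝 (Φ t p).proj,
    ∃ c : ℝ → CotangentBundle d M,
      IsShortestGeodesic d (fun s => (c s).proj) (Φ t p).proj x ∧
      c 0 = Φ t p ∧ IsParallelCovector c ∧
      φ t x p =
        ((∫ s in (0 : ℝ)..1, pairing (c s).2 (velocity (fun σ => (c σ).proj) s) : ℝ) : ℂ)
          + Complex.I * ε / 2 * ham p * (dist x (Φ t p).proj : ℂ) ^ 2

end Riemannian

section Derivatives

variable {d : ℕ} {M : Type*} [MetricSpace M] [ChartedSpace (Model d) M]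

/-- The component `[x*(t; y, η)]^α` in the coordinates `e`, as a function of `η ∈ T*_y M`. -/
def xStar (e : OpenPartialHomeomorph M (Model d))
    (Φ : ℝ → CotangentBundle d M → CotangentBundle d M) (t : ℝ) (y : M) (α : Fin d)
    (η : Cotangent d y) : ℝ :=
  e (Φ t ⟨y, η⟩).proj α

/-- The component `ξ*_α(t; y, η)` in the coordinates `e`, as a function of `η ∈ T*_y M`. -/
def xiStar (e : OpenPartialHomeomorph M (Model d))
    (Φ : ℝ → CotangentBundle d M → CotangentBundle d M) (t : ℝ) (y : M) (α : Fin d)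
    (η : Cotangent d y) : ℝ :=
  momCoord e (Φ t ⟨y, η⟩) α

/-- `∂F/∂η_μ` for a function of `η ∈ T*_y M`, where `η = η_μ dy^μ` in the coordinates `y` given by
the chart `e'`. -/
def etaD (e' : OpenPartialHomeomorph M (Model d)) {F : Type*} [NormedAddCommGroup F]
    [NormedSpace ℝ F] {y : M} (f : Cotangent d y → F) (μ : Fin d) (η : Cotangent d y) : F :=
  lineDeriv ℝ f η (coordCovec e' y μ)

/-- `∂f/∂η_μ` exists at `η`. -/
def EtaDifferentiableAt (e' : OpenPartialHomeomorph M (Model d)) {F : Type*}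
    [NormedAddCommGroup F] [NormedSpace ℝ F] {y : M} (f : Cotangent d y → F) (μ : Fin d)
    (η : Cotangent d y) : Prop :=
  LineDifferentiableAt ℝ f η (coordCovec e' y μ)

/-- `q^{αμ}(η; t, y) = ∂[x*(η)]^α / ∂η_μ`. -/
def q (e e' : OpenPartialHomeomorph M (Model d))
    (Φ : ℝ → CotangentBundle d M → CotangentBundle d M) (t : ℝ) (y : M) (η : Cotangent d y)
    (α μ : Fin d) : ℝ :=
  etaD e' (xStar e Φ t y α) μ η

/-- `p^{αμ}(η; t, y) = g^{αγ}(x*) [∂ξ*_γ/∂η_μ - Γ^ρ_{γβ}(x*) ξ*_ρ ∂(x*)^β/∂η_μ]`. -/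
def p [RiemannianBundle (fun x : M => TangentSpace 𝓘(ℝ, Model d) x)]
    (e e' : OpenPartialHomeomorph M (Model d))
    (Φ : ℝ → CotangentBundle d M → CotangentBundle d M) (t : ℝ) (y : M) (η : Cotangent d y)
    (α μ : Fin d) : ℝ :=
  ∑ γ, gUp e (e (Φ t ⟨y, η⟩).proj) α γ *
    (etaD e' (xiStar e Φ t y γ) μ η
      - ∑ ρ, ∑ β, christoffel e (e (Φ t ⟨y, η⟩).proj) ρ γ β
          * xiStar e Φ t y ρ η * etaD e' (xStar e Φ t y β) μ η)

/-- `φ_{x^α}(t, x; y, η)` at the point `x` with coordinates `u` in the chart `e`. -/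
def phiX (e : OpenPartialHomeomorph M (Model d)) (φ : ℝ → M → CotangentBundle d M → ℂ)
    (t : ℝ) (y : M) (α : Fin d) (u : Model d) (η : Cotangent d y) : ℂ :=
  partialD (fun v => φ t (e.symm v) ⟨y, η⟩) α u

end Derivatives

end LeviCivitaPhase

end

/-! In local coordinates a shortest geodesic from `x*` to `x` with initial velocity `v` satisfies
`x - x* = v - Γ(v, v) / 2 + o(|v|²)`, while the pairing of a parallel covector with the velocity
and the speed are constant along it. So near `x*` the phase function is
`ξ*(v) + i ε h g(v, v) / 2`, and inverting the expansion gives `φ_x = ξ*` and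
`φ_xx = Γ^ρ ξ*_ρ + i ε h g` at `x = x*`.

Hence `x*` is a nondegenerate critical point of `x ↦ Im φ`. By the implicit function theorem,
near `(t, x*)` this critical point is a `C¹` function of `(t, η)`, and connectedness of the time
axis carries continuity in `η` of the projected flow from `t = 0` to all times. So `x*`, and then
`ξ* = φ_x(x*)`, is differentiable in `η`, and differentiating `φ_x(t, x*(η); y, η) = ξ*(η)` gives
the formula.
-/

namespace LeviCivitaPhase

section CoordinateSpace

variable {d : ℕ} {F : Type*} [NormedAddCommGroup F] [NormedSpace ℝ F]

theorem hasDerivAt_coord {k : ℝ → Model d} {k' : Model d} {s : ℝ} (h : HasDerivAt k k' s)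
    (α : Fin d) : HasDerivAt (fun τ => k τ α) (k' α) s :=
  (EuclideanSpace.proj α : Model d →L[ℝ] ℝ).hasFDerivAt.comp_hasDerivAt s h

/-- The bilinear map `(a, b) ↦ a^α b^β c_{αβ}` on the coordinate space with coefficients `c`. -/
noncomputable def bilinOfCoeff (c : Fin d → Fin d → F) : Model d →ₗ[ℝ] Model d →ₗ[ℝ] F :=
  ∑ α, ∑ β, ((EuclideanSpace.proj α : Model d →L[ℝ] ℝ) : Model d →ₗ[ℝ] ℝ).smulRight
    (((EuclideanSpace.proj β : Model d →L[ℝ] ℝ) : Model d →ₗ[ℝ] ℝ).smulRight (c α β))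

theorem bilinOfCoeff_apply (c : Fin d → Fin d → F) (a b : Model d) :
    bilinOfCoeff c a b = ∑ α, ∑ β, (a α * b β) • c α β := by
  simp [bilinOfCoeff, mul_smul]

theorem norm_bilinOfCoeff_le (c : Fin d → Fin d → F) (a b : Model d) :
    ‖bilinOfCoeff c a b‖ ≤ (∑ α, ∑ β, ‖c α β‖) * ‖a‖ * ‖b‖ := by
  rw [bilinOfCoeff_apply]
  simp only [Finset.sum_mul]
  refine norm_sum_le_of_le _ fun α _ => norm_sum_le_of_le _ fun β _ => ?_
  calc ‖(a α * b β) • c α β‖ = ‖a α‖ * ‖b β‖ * ‖c α β‖ := by rw [norm_smul, norm_mul]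
    _ ≤ ‖a‖ * ‖b‖ * ‖c α β‖ := by
        gcongr <;> exact PiLp.norm_apply_le _ _
    _ = ‖c α β‖ * ‖a‖ * ‖b‖ := by ring

theorem eventually_norm_bilinOfCoeff_sub_le {X : Type*} [TopologicalSpace X]
    {c : X → Fin d → Fin d → F} {u : X} (hc : ∀ α β, ContinuousAt (fun v => c v α β) u) {δ : ℝ}
    (hδ : 0 < δ) :
    ∀ᶠ v in 𝓝 u, ∀ a b, ‖bilinOfCoeff (c v) a b - bilinOfCoeff (c u) a b‖ ≤ δ * ‖a‖ * ‖b‖ := by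
  have hcont : ContinuousAt (fun v => ∑ α, ∑ β, ‖c v α β - c u α β‖) u := by fun_prop
  have hsmall : ∀ᶠ v in 𝓝 u, ∑ α, ∑ β, ‖c v α β - c u α β‖ < δ :=
    hcont.eventually_lt_const (by simpa using hδ)
  filter_upwards [hsmall] with v hv a b
  have hsub : bilinOfCoeff (c v) a b - bilinOfCoeff (c u) a b =
      bilinOfCoeff (fun α β => c v α β - c u α β) a b := by
    simp only [bilinOfCoeff_apply, smul_sub, Finset.sum_sub_distrib]
  rw [hsub]
  exact (norm_bilinOfCoeff_le _ a b).trans (by gcongr)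

theorem bilinOfCoeff_comm {c : Fin d → Fin d → F} (hc : ∀ α β, c α β = c β α)
    (a b : Model d) : bilinOfCoeff c a b = bilinOfCoeff c b a := by
  rw [bilinOfCoeff_apply, bilinOfCoeff_apply, Finset.sum_comm]
  exact Finset.sum_congr rfl fun β _ => Finset.sum_congr rfl fun α _ => by rw [hc, mul_comm]

theorem hasDerivAt_bilinOfCoeff {c : ℝ → Fin d → Fin d → F} {c' : Fin d → Fin d → F}
    {v w : ℝ → Model d} {v' w' : Model d} {s : ℝ}
    (hc : ∀ α β, HasDerivAt (fun τ => c τ α β) (c' α β) s) (hv : HasDerivAt v v' s)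
    (hw : HasDerivAt w w' s) :
    HasDerivAt (fun τ => bilinOfCoeff (c τ) (v τ) (w τ))
      (bilinOfCoeff c' (v s) (w s) + bilinOfCoeff (c s) v' (w s) + bilinOfCoeff (c s) (v s) w')
      s := by
  simp only [bilinOfCoeff_apply, ← Finset.sum_add_distrib]
  refine HasDerivAt.fun_sum fun α _ => HasDerivAt.fun_sum fun β _ => ?_
  refine (((hasDerivAt_coord hv α).mul (hasDerivAt_coord hw β)).smul (hc α β)).congr_deriv ?_
  simp only [Pi.mul_apply, add_smul]
  abel

theorem eq_sum_smul_single (a : Model d) : a = ∑ σ, a σ • EuclideanSpace.single σ (1 : ℝ) := by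
  ext i
  simp [Finset.sum_apply, Pi.single_apply]

theorem fderiv_apply_eq_sum_partialD {f : Model d → F} {u : Model d}
    (hf : DifferentiableAt ℝ f u) (a : Model d) :
    fderiv ℝ f u a = ∑ σ, a σ • partialD f σ u := by
  conv_lhs => rw [eq_sum_smul_single a]
  simp only [map_sum, map_smul, partialD, hf.lineDeriv_eq_fderiv]

end CoordinateSpace

section Chart

variable {d : ℕ} {M : Type*} [TopologicalSpace M] [ChartedSpace (Model d) M]
  {e : OpenPartialHomeomorph M (Model d)}

/-- The components `v^α` of a tangent vector in the chart `e`. -/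
noncomputable def vecCoord (e : OpenPartialHomeomorph M (Model d)) {x : M}
    (v : TangentSpace 𝓘(ℝ, Model d) x) : Model d :=
  mfderiv 𝓘(ℝ, Model d) 𝓘(ℝ, Model d) e x v

/-- The components `ξ_α` of a covector in the chart `e`, assembled into the linear form
`a ↦ ξ_α a^α` on the coordinate space. -/
noncomputable def momForm (e : OpenPartialHomeomorph M (Model d)) (p : CotangentBundle d M) :
    Model d →L[ℝ] ℝ :=
  ∑ α, momCoord e p α • (EuclideanSpace.proj α : Model d →L[ℝ] ℝ)

theorem momForm_apply (p : CotangentBundle d M) (a : Model d) :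
    momForm e p a = ∑ α, momCoord e p α * a α := by
  simp [momForm]

theorem momForm_single (p : CotangentBundle d M) (α : Fin d) :
    momForm e p (EuclideanSpace.single α 1) = momCoord e p α := by
  simp [momForm_apply]

theorem hasDerivAt_momForm {c : ℝ → CotangentBundle d M} {L : Model d →L[ℝ] ℝ} {s : ℝ}
    (h : ∀ β, HasDerivAt (fun τ => momCoord e (c τ) β) (L (EuclideanSpace.single β 1)) s) :
    HasDerivAt (fun τ => momForm e (c τ)) L s := by
  refine (HasDerivAt.fun_sum fun β _ => (h β).smul_const _).congr_deriv ?_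
  ext a
  conv_rhs => rw [eq_sum_smul_single a]
  simp [mul_comm]

theorem mdifferentiable_of_mem_maximalAtlas
    (he : e ∈ IsManifold.maximalAtlas 𝓘(ℝ, Model d) ∞ M) :
    e.MDifferentiable 𝓘(ℝ, Model d) 𝓘(ℝ, Model d) :=
  ⟨(contMDiffOn_of_mem_maximalAtlas he).mdifferentiableOn (by simp),
    (contMDiffOn_symm_of_mem_maximalAtlas he).mdifferentiableOn (by simp)⟩

theorem isInvertible_mfderiv_chart (he : e ∈ IsManifold.maximalAtlas 𝓘(ℝ, Model d) ∞ M) {x : M}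
    (hx : x ∈ e.source) : (mfderiv 𝓘(ℝ, Model d) 𝓘(ℝ, Model d) e x).IsInvertible :=
  ⟨(mdifferentiable_of_mem_maximalAtlas he).mfderiv hx, rfl⟩

theorem vecCoord_coordVec (he : e ∈ IsManifold.maximalAtlas 𝓘(ℝ, Model d) ∞ M) {x : M}
    (hx : x ∈ e.source) (α : Fin d) :
    vecCoord e (coordVec e x α) = EuclideanSpace.single α 1 :=
  (isInvertible_mfderiv_chart he hx).self_apply_inverse _

theorem vecCoord_injective (he : e ∈ IsManifold.maximalAtlas 𝓘(ℝ, Model d) ∞ M) {x : M}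
    (hx : x ∈ e.source) :
    Function.Injective (vecCoord e : TangentSpace 𝓘(ℝ, Model d) x → Model d) :=
  (isInvertible_mfderiv_chart he hx).injective

theorem eq_sum_coordVec (he : e ∈ IsManifold.maximalAtlas 𝓘(ℝ, Model d) ∞ M) {x : M}
    (hx : x ∈ e.source) (v : TangentSpace 𝓘(ℝ, Model d) x) :
    v = ∑ α, vecCoord e v α • coordVec e x α := by
  apply vecCoord_injective he hx
  calc vecCoord e v = ∑ α, vecCoord e v α • vecCoord e (coordVec e x α) := by
        simp_rw [vecCoord_coordVec he hx]
        exact eq_sum_smul_single _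
    _ = vecCoord e (∑ α, vecCoord e v α • coordVec e x α) := by
        refine ((map_sum (mfderiv 𝓘(ℝ, Model d) 𝓘(ℝ, Model d) e x) _ _).trans ?_).symm
        exact Finset.sum_congr rfl fun α _ => map_smul _ _ _

theorem pairing_eq_momForm (he : e ∈ IsManifold.maximalAtlas 𝓘(ℝ, Model d) ∞ M)
    {p : CotangentBundle d M} (hp : p.proj ∈ e.source)
    (v : TangentSpace 𝓘(ℝ, Model d) p.proj) :
    pairing p.2 v = momForm e p (vecCoord e v) := by
  rw [momForm_apply]
  conv_lhs => rw [eq_sum_coordVec he hp v]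
  simp [pairing, momCoord, mul_comm]

theorem hasDerivAt_chart_comp (he : e ∈ IsManifold.maximalAtlas 𝓘(ℝ, Model d) ∞ M)
    {γ : ℝ → M} {s : ℝ} (hγ : MDifferentiableAt 𝓘(ℝ, ℝ) 𝓘(ℝ, Model d) γ s)
    (hs : γ s ∈ e.source) :
    HasDerivAt (fun τ => e (γ τ)) (vecCoord e (velocity γ s)) s := by
  have he' := ((mdifferentiable_of_mem_maximalAtlas he).mdifferentiableAt hs).hasMFDerivAt
  obtain ⟨L, hL, hv⟩ : ∃ L : ℝ →L[ℝ] Model d,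
      HasFDerivAt (fun τ => e (γ τ)) L s ∧ L 1 = vecCoord e (velocity γ s) :=
    ⟨_, (he'.comp s hγ.hasMFDerivAt).hasFDerivAt, rfl⟩
  exact hv ▸ hL.hasDerivAt

end Chart

section MetricCoordinates

variable {d : ℕ} {M : Type*} [MetricSpace M] [ChartedSpace (Model d) M]
  [RiemannianBundle (fun x : M => TangentSpace 𝓘(ℝ, Model d) x)]
  {e : OpenPartialHomeomorph M (Model d)}

/-- The metric `(a, b) ↦ g_{αβ}(u) a^α b^β` in the chart `e`. -/
noncomputable def metricForm (e : OpenPartialHomeomorph M (Model d)) (u : Model d) :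
    Model d →ₗ[ℝ] Model d →ₗ[ℝ] ℝ :=
  bilinOfCoeff fun α β => gLow e u α β

/-- The Christoffel symbols in the chart `e` as the vector-valued bilinear map
`(a, b) ↦ Γ^ρ_{αβ}(u) a^α b^β`. -/
noncomputable def christoffelForm (e : OpenPartialHomeomorph M (Model d)) (u : Model d) :
    Model d →ₗ[ℝ] Model d →ₗ[ℝ] Model d :=
  bilinOfCoeff fun α β => WithLp.toLp 2 fun ρ => christoffel e u ρ α β

theorem exists_norm_metricForm_le (e : OpenPartialHomeomorph M (Model d)) (u : Model d) :
    ∃ K, 0 ≤ K ∧ ∀ a b, ‖metricForm e u a b‖ ≤ K * ‖a‖ * ‖b‖ :=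
  ⟨_, by positivity, norm_bilinOfCoeff_le _⟩

theorem exists_norm_christoffelForm_le (e : OpenPartialHomeomorph M (Model d)) (u : Model d) :
    ∃ K, 0 ≤ K ∧ ∀ a b, ‖christoffelForm e u a b‖ ≤ K * ‖a‖ * ‖b‖ :=
  ⟨_, by positivity, norm_bilinOfCoeff_le _⟩

theorem metricForm_apply (u a b : Model d) :
    metricForm e u a b = ∑ α, ∑ β, gLow e u α β * a α * b β := by
  simp only [metricForm, bilinOfCoeff_apply, smul_eq_mul]
  exact Finset.sum_congr rfl fun α _ => Finset.sum_congr rfl fun β _ => by ring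

theorem christoffelForm_apply (u a b : Model d) (ρ : Fin d) :
    christoffelForm e u a b ρ = ∑ α, ∑ β, christoffel e u ρ α β * a α * b β := by
  simp only [christoffelForm, bilinOfCoeff_apply, WithLp.ofLp_sum, WithLp.ofLp_smul,
    Finset.sum_apply, Pi.smul_apply, smul_eq_mul]
  exact Finset.sum_congr rfl fun α _ => Finset.sum_congr rfl fun β _ => by ring

theorem gLow_comm (u : Model d) (α β : Fin d) : gLow e u α β = gLow e u β α := by
  simp [gLow, real_inner_comm]

theorem metricForm_comm (u a b : Model d) : metricForm e u a b = metricForm e u b a :=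
  bilinOfCoeff_comm (gLow_comm u) a b

theorem christoffel_comm (u : Model d) (ρ α β : Fin d) :
    christoffel e u ρ α β = christoffel e u ρ β α := by
  unfold christoffel
  simp_rw [gLow_comm (e := e) _ α β]
  congr! 3
  ring

theorem christoffelForm_comm (u a b : Model d) :
    christoffelForm e u a b = christoffelForm e u b a :=
  bilinOfCoeff_comm (fun α β => by simp_rw [christoffel_comm u _ α β]) a b

theorem inner_eq_metricForm (he : e ∈ IsManifold.maximalAtlas 𝓘(ℝ, Model d) ∞ M) {x : M}
    (hx : x ∈ e.source) (v w : TangentSpace 𝓘(ℝ, Model d) x) :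
    inner ℝ v w = metricForm e (e x) (vecCoord e v) (vecCoord e w) := by
  rw [metricForm_apply]
  conv_lhs => rw [eq_sum_coordVec he hx v, eq_sum_coordVec he hx w]
  simp only [sum_inner, inner_sum, real_inner_smul_left, real_inner_smul_right]
  rw [Finset.sum_comm]
  refine Finset.sum_congr rfl fun α _ => Finset.sum_congr rfl fun β _ => ?_
  rw [gLow, Matrix.of_apply, e.left_inv hx]
  ring

theorem metricForm_pos (he : e ∈ IsManifold.maximalAtlas 𝓘(ℝ, Model d) ∞ M) {u : Model d}
    (hu : u ∈ e.target) {a : Model d} (ha : a ≠ 0) : 0 < metricForm e u a a := by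
  have hx := e.map_target hu
  obtain ⟨v, rfl : vecCoord e v = a⟩ :=
    (mdifferentiable_of_mem_maximalAtlas he).mfderiv_surjective hx a
  have hv : v ≠ 0 := by
    rintro rfl
    exact ha (map_zero _)
  have hinner := inner_eq_metricForm he hx v v
  rw [e.right_inv hu, real_inner_self_eq_norm_sq] at hinner
  exact hinner ▸ by positivity

theorem exists_pos_forall_le_metricForm (he : e ∈ IsManifold.maximalAtlas 𝓘(ℝ, Model d) ∞ M)
    {u : Model d} (hu : u ∈ e.target) : ∃ κ > 0, ∀ a, κ * ‖a‖ ^ 2 ≤ metricForm e u a a := by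
  have hcont : Continuous fun a => metricForm e u a a := by
    simp only [metricForm_apply]
    fun_prop
  rcases subsingleton_or_nontrivial (Model d) with _ | _
  · exact ⟨1, one_pos, fun a => by simp [Subsingleton.elim a 0]⟩
  obtain ⟨b, hb, hmin⟩ := (isCompact_sphere (0 : Model d) 1).exists_isMinOn
    (NormedSpace.sphere_nonempty.2 zero_le_one) hcont.continuousOn
  refine ⟨metricForm e u b b, metricForm_pos he hu (ne_zero_of_mem_unit_sphere ⟨b, hb⟩),
    fun a => ?_⟩
  rcases eq_or_ne a 0 with rfl | ha
  · simp
  have hnorm : ‖a‖⁻¹ • a ∈ Metric.sphere (0 : Model d) 1 := by simp [norm_smul, ha]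
  calc metricForm e u b b * ‖a‖ ^ 2
      ≤ metricForm e u (‖a‖⁻¹ • a) (‖a‖⁻¹ • a) * ‖a‖ ^ 2 := by gcongr; exact hmin hnorm
    _ = metricForm e u a a := by
      simp only [map_smul, LinearMap.smul_apply, smul_eq_mul]
      field_simp [norm_ne_zero_iff.2 ha]

theorem gLow_posDef (he : e ∈ IsManifold.maximalAtlas 𝓘(ℝ, Model d) ∞ M) {u : Model d}
    (hu : u ∈ e.target) : (gLow e u).PosDef := by
  refine Matrix.PosDef.of_dotProduct_mulVec_pos (by ext α β; simp [gLow_comm u α β]) ?_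
  intro a ha
  refine (metricForm_pos he hu (a := WithLp.toLp 2 a) (by simpa using ha)).trans_eq ?_
  simp only [metricForm_apply, dotProduct, mulVec, star_trivial, Finset.mul_sum]
  exact Finset.sum_congr rfl fun α _ => Finset.sum_congr rfl fun β _ => by ring

theorem ham_pos [IsManifold 𝓘(ℝ, Model d) ∞ M] {p : CotangentBundle d M} (hp : p.2 ≠ 0) :
    0 < ham p := by
  set e := chartAt (Model d) p.proj with he_def
  have he : e ∈ IsManifold.maximalAtlas 𝓘(ℝ, Model d) ∞ M :=
    IsManifold.chart_mem_maximalAtlas p.proj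
  have hx : p.proj ∈ e.source := mem_chart_source _ _
  have hξ : momCoord e p ≠ 0 := by
    intro h0
    apply hp
    ext v
    refine (pairing_eq_momForm he hx v).trans ?_
    simp [momForm_apply, h0]
  refine Real.sqrt_pos.2 (((gLow_posDef he (e.map_source hx)).inv.dotProduct_mulVec_pos
    hξ).trans_eq ?_)
  simp only [gUp, dotProduct, mulVec, star_trivial, Finset.mul_sum, ← he_def]
  exact Finset.sum_congr rfl fun α _ => Finset.sum_congr rfl fun β _ => by ring

end MetricCoordinates

section MetricSmoothness

variable {d : ℕ} {M : Type*} [MetricSpace M] [ChartedSpace (Model d) M]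
  [IsManifold 𝓘(ℝ, Model d) ∞ M]
  {e : OpenPartialHomeomorph M (Model d)} {u : Model d}

theorem contMDiffOn_coordVec (he : e ∈ IsManifold.maximalAtlas 𝓘(ℝ, Model d) ∞ M) (α : Fin d) :
    ContMDiffOn 𝓘(ℝ, Model d) (𝓘(ℝ, Model d).prod 𝓘(ℝ, Model d)) ∞
      (fun u : Model d => (⟨e.symm u, coordVec e (e.symm u) α⟩ :
        TotalSpace (Model d) (fun x : M => TangentSpace 𝓘(ℝ, Model d) x))) e.target := by
  have hsymm := (contMDiffOn_symm_of_mem_maximalAtlas he).contMDiffOn_tangentMapWithin (m := ∞)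
    (by simp) e.open_target.uniqueMDiffOn
  have hconst : ContMDiff 𝓘(ℝ, Model d) (𝓘(ℝ, Model d).prod 𝓘(ℝ, Model d)) ∞
      (fun u : Model d => (⟨u, (EuclideanSpace.single α (1 : ℝ) : Model d)⟩ :
        TangentBundle 𝓘(ℝ, Model d) (Model d))) :=
    contMDiff_vectorSpace_iff_contDiff.2 contDiff_const
  refine (hsymm.comp hconst.contMDiffOn (s := e.target) fun u hu => hu).congr fun u hu => ?_
  simp only [Function.comp, tangentMapWithin]
  rw [mfderivWithin_of_isOpen e.open_target hu]
  congr 1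
  apply vecCoord_injective he (e.map_target hu)
  have hinv := (mdifferentiable_of_mem_maximalAtlas he).symm.symm_comp_deriv (x := u) hu
  exact (vecCoord_coordVec he (e.map_target hu) α).trans
    (congrArg (fun L => L (EuclideanSpace.single α (1 : ℝ) : Model d)) hinv).symm

variable [RiemannianBundle (fun x : M => TangentSpace 𝓘(ℝ, Model d) x)]
  [IsContMDiffRiemannianBundle 𝓘(ℝ, Model d) ∞ (Model d)
      (fun x : M => TangentSpace 𝓘(ℝ, Model d) x)]

theorem contDiffOn_gLow (he : e ∈ IsManifold.maximalAtlas 𝓘(ℝ, Model d) ∞ M) (α β : Fin d) :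
    ContDiffOn ℝ ∞ (fun u => gLow e u α β) e.target := by
  rw [← contMDiffOn_iff_contDiffOn]
  exact (contMDiffOn_coordVec he α).inner_bundle (contMDiffOn_coordVec he β)

theorem differentiableAt_gLow (he : e ∈ IsManifold.maximalAtlas 𝓘(ℝ, Model d) ∞ M)
    (hu : u ∈ e.target) (α β : Fin d) : DifferentiableAt ℝ (fun u => gLow e u α β) u :=
  ((contDiffOn_gLow he α β).contDiffAt (e.open_target.mem_nhds hu)).differentiableAt (by simp)

theorem continuousOn_gUp (he : e ∈ IsManifold.maximalAtlas 𝓘(ℝ, Model d) ∞ M) (α β : Fin d) :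
    ContinuousOn (fun u => gUp e u α β) e.target := by
  have hg : ContinuousOn (gLow e) e.target :=
    continuousOn_pi.2 fun α => continuousOn_pi.2 fun β => (contDiffOn_gLow he α β).continuousOn
  have hinv : ContinuousOn (gUp e) e.target := by
    unfold gUp
    simp_rw [Matrix.inv_def, Ring.inverse_eq_inv']
    exact ((continuous_id.matrix_det.comp_continuousOn hg).inv₀
      fun u hu => (gLow_posDef he hu).det_pos.ne').smul
      (continuous_id.matrix_adjugate.comp_continuousOn hg)
  exact continuousOn_pi.1 (continuousOn_pi.1 hinv α) β

theorem continuousOn_partialD_gLow (he : e ∈ IsManifold.maximalAtlas 𝓘(ℝ, Model d) ∞ M)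
    (α β σ : Fin d) : ContinuousOn (partialD (fun u => gLow e u α β) σ) e.target := by
  have hfderiv := (contDiffOn_gLow he α β).continuousOn_fderiv_of_isOpen e.open_target (by simp)
  exact (hfderiv.clm_apply (continuousOn_const (c := EuclideanSpace.single σ (1 : ℝ)))).congr
    fun u hu => (differentiableAt_gLow he hu α β).lineDeriv_eq_fderiv

theorem continuousOn_christoffel (he : e ∈ IsManifold.maximalAtlas 𝓘(ℝ, Model d) ∞ M)
    (ρ α β : Fin d) : ContinuousOn (fun u => christoffel e u ρ α β) e.target := by
  refine ContinuousOn.mul continuousOn_const (continuousOn_finsetSum _ fun σ _ => ?_)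
  exact (continuousOn_gUp he ρ σ).mul (((continuousOn_partialD_gLow he _ _ _).add
    (continuousOn_partialD_gLow he _ _ _)).sub (continuousOn_partialD_gLow he _ _ _))

theorem eventually_norm_metricForm_sub_le (he : e ∈ IsManifold.maximalAtlas 𝓘(ℝ, Model d) ∞ M)
    (hu : u ∈ e.target) {δ : ℝ} (hδ : 0 < δ) :
    ∀ᶠ v in 𝓝 u, ∀ a b, ‖metricForm e v a b - metricForm e u a b‖ ≤ δ * ‖a‖ * ‖b‖ :=
  eventually_norm_bilinOfCoeff_sub_le
    (fun α β => (differentiableAt_gLow he hu α β).continuousAt) hδ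

theorem eventually_norm_christoffelForm_sub_le
    (he : e ∈ IsManifold.maximalAtlas 𝓘(ℝ, Model d) ∞ M) (hu : u ∈ e.target) {δ : ℝ}
    (hδ : 0 < δ) :
    ∀ᶠ v in 𝓝 u, ∀ a b, ‖christoffelForm e v a b - christoffelForm e u a b‖ ≤ δ * ‖a‖ * ‖b‖ :=
  eventually_norm_bilinOfCoeff_sub_le (fun α β =>
    (PiLp.continuous_toLp 2 _).continuousAt.comp (continuousAt_pi.2 fun ρ =>
      (continuousOn_christoffel he ρ α β).continuousAt (e.open_target.mem_nhds hu))) hδ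

end MetricSmoothness

section ChristoffelIdentity

variable {d : ℕ} {M : Type*} [MetricSpace M] [ChartedSpace (Model d) M]
  [RiemannianBundle (fun x : M => TangentSpace 𝓘(ℝ, Model d) x)]
  {e : OpenPartialHomeomorph M (Model d)} {u : Model d}

theorem gLow_mulVec_gUp_mulVec (he : e ∈ IsManifold.maximalAtlas 𝓘(ℝ, Model d) ∞ M)
    (hu : u ∈ e.target) (f : Fin d → ℝ) : gLow e u *ᵥ gUp e u *ᵥ f = f := by
  have hg : gLow e u * gUp e u = 1 := Matrix.mul_nonsing_inv _
    ((Matrix.isUnit_iff_isUnit_det _).1 (gLow_posDef he hu).isUnit)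
  rw [Matrix.mulVec_mulVec, hg, Matrix.one_mulVec]

theorem sum_gLow_mul_christoffel (he : e ∈ IsManifold.maximalAtlas 𝓘(ℝ, Model d) ∞ M)
    (hu : u ∈ e.target) (μ α β : Fin d) :
    ∑ ρ, gLow e u μ ρ * christoffel e u ρ α β = (1 / 2) *
      (partialD (fun v => gLow e v μ β) α u + partialD (fun v => gLow e v μ α) β u
      - partialD (fun v => gLow e v α β) μ u) := by
  set f : Fin d → ℝ := fun σ => partialD (fun v => gLow e v σ β) α u +
    partialD (fun v => gLow e v σ α) β u - partialD (fun v => gLow e v α β) σ u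
  change ∑ ρ, gLow e u μ ρ * ((1 / 2) * (gUp e u *ᵥ f) ρ) = (1 / 2) * f μ
  rw [← congrFun (gLow_mulVec_gUp_mulVec he hu f) μ]
  simp only [mulVec, dotProduct, Finset.mul_sum, mul_left_comm]

theorem metricForm_christoffelForm (he : e ∈ IsManifold.maximalAtlas 𝓘(ℝ, Model d) ∞ M)
    (hu : u ∈ e.target) (a b c : Model d) :
    metricForm e u a (christoffelForm e u b c) = ∑ μ, ∑ α, ∑ β, (1 / 2) *
      (partialD (fun v => gLow e v μ β) α u + partialD (fun v => gLow e v μ α) β u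
      - partialD (fun v => gLow e v α β) μ u) * (a μ * b α * c β) := by
  rw [metricForm_apply]
  refine Finset.sum_congr rfl fun μ _ => ?_
  simp_rw [← sum_gLow_mul_christoffel he hu, christoffelForm_apply, Finset.mul_sum,
    Finset.sum_mul]
  rw [Finset.sum_comm]
  refine Finset.sum_congr rfl fun α _ => ?_
  rw [Finset.sum_comm]
  exact Finset.sum_congr rfl fun β _ => Finset.sum_congr rfl fun ρ _ => by ring

/-- The derivative `(b, c) ↦ a^σ ∂_σ g_{αβ}(u) b^α c^β` of the metric in the direction `a` in the
chart `e`. -/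
noncomputable def metricFormDeriv (e : OpenPartialHomeomorph M (Model d)) (u a : Model d) :
    Model d →ₗ[ℝ] Model d →ₗ[ℝ] ℝ :=
  bilinOfCoeff fun α β => ∑ σ, a σ • partialD (fun v => gLow e v α β) σ u

theorem metricFormDeriv_apply (u a b c : Model d) :
    metricFormDeriv e u a b c =
      ∑ σ, ∑ α, ∑ β, partialD (fun v => gLow e v α β) σ u * (a σ * b α * c β) := by
  simp only [metricFormDeriv, bilinOfCoeff_apply, smul_eq_mul, Finset.mul_sum]
  rw [Finset.sum_comm_cycle]
  exact Finset.sum_congr rfl fun σ _ => Finset.sum_congr rfl fun α _ =>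
    Finset.sum_congr rfl fun β _ => by ring

theorem two_mul_metricForm_christoffelForm (he : e ∈ IsManifold.maximalAtlas 𝓘(ℝ, Model d) ∞ M)
    (hu : u ∈ e.target) (a b c : Model d) :
    2 * metricForm e u a (christoffelForm e u b c) =
      metricFormDeriv e u b a c + metricFormDeriv e u c a b - metricFormDeriv e u a b c := by
  have hb : metricFormDeriv e u b a c = ∑ μ, ∑ α, ∑ β,
      partialD (fun v => gLow e v μ β) α u * (a μ * b α * c β) := by
    rw [metricFormDeriv_apply, Finset.sum_comm]
    simp only [mul_comm (b _)]
  have hc : metricFormDeriv e u c a b = ∑ μ, ∑ α, ∑ β,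
      partialD (fun v => gLow e v μ α) β u * (a μ * b α * c β) := by
    rw [metricFormDeriv_apply, Finset.sum_comm]
    refine Finset.sum_congr rfl fun μ _ => ?_
    rw [Finset.sum_comm]
    exact Finset.sum_congr rfl fun α _ => Finset.sum_congr rfl fun β _ => by ring
  rw [hb, hc, metricFormDeriv_apply, metricForm_christoffelForm he hu]
  simp only [Finset.mul_sum, ← Finset.sum_add_distrib, ← Finset.sum_sub_distrib]
  exact Finset.sum_congr rfl fun μ _ => Finset.sum_congr rfl fun α _ =>
    Finset.sum_congr rfl fun β _ => by ring

theorem hasDerivAt_metricForm_self {k v : ℝ → Model d} {k' v' : Model d} {s : ℝ}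
    (hg : ∀ α β, DifferentiableAt ℝ (fun u => gLow e u α β) (k s)) (hk : HasDerivAt k k' s)
    (hv : HasDerivAt v v' s) :
    HasDerivAt (fun τ => metricForm e (k τ) (v τ) (v τ))
      (metricFormDeriv e (k s) k' (v s) (v s) + 2 * metricForm e (k s) (v s) v') s := by
  have hcoeff : ∀ α β, HasDerivAt (fun τ => gLow e (k τ) α β)
      (∑ σ, k' σ • partialD (fun u => gLow e u α β) σ (k s)) s := fun α β => by
    rw [← fderiv_apply_eq_sum_partialD (hg α β)]
    exact (hg α β).hasFDerivAt.comp_hasDerivAt s hk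
  refine (hasDerivAt_bilinOfCoeff hcoeff hv hv).congr_deriv ?_
  change metricFormDeriv e (k s) k' (v s) (v s) + metricForm e (k s) v' (v s) +
    metricForm e (k s) (v s) v' = _
  rw [metricForm_comm _ v']
  ring

end ChristoffelIdentity

section Geodesics

variable {d : ℕ} {M : Type*} [MetricSpace M] [ChartedSpace (Model d) M]
  [IsManifold 𝓘(ℝ, Model d) ∞ M]
  [RiemannianBundle (fun x : M => TangentSpace 𝓘(ℝ, Model d) x)]
  {e : OpenPartialHomeomorph M (Model d)}

theorem IsGeodesic.mdifferentiableAt {γ : ℝ → M} (hγ : IsGeodesic d γ) (s : ℝ) :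
    MDifferentiableAt 𝓘(ℝ, ℝ) 𝓘(ℝ, Model d) γ s :=
  hγ.1.mdifferentiable (by simp) s

theorem IsGeodesic.eventually_mem_source {γ : ℝ → M} (hγ : IsGeodesic d γ) {s : ℝ}
    (hs : γ s ∈ e.source) : ∀ᶠ τ in 𝓝 s, γ τ ∈ e.source :=
  hγ.1.continuous.continuousAt.eventually (e.open_source.mem_nhds hs)

theorem IsGeodesic.hasDerivAt_chart_comp
    (he : e ∈ IsManifold.maximalAtlas 𝓘(ℝ, Model d) ∞ M) {γ : ℝ → M} (hγ : IsGeodesic d γ)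
    {s : ℝ} (hs : γ s ∈ e.source) :
    HasDerivAt (fun τ => e (γ τ)) (vecCoord e (velocity γ s)) s :=
  LeviCivitaPhase.hasDerivAt_chart_comp he (hγ.mdifferentiableAt s) hs

theorem IsGeodesic.eventuallyEq_deriv_chart_comp
    (he : e ∈ IsManifold.maximalAtlas 𝓘(ℝ, Model d) ∞ M) {γ : ℝ → M} (hγ : IsGeodesic d γ)
    {s : ℝ} (hs : γ s ∈ e.source) :
    deriv (fun τ => e (γ τ)) =ᶠ[𝓝 s] fun τ => vecCoord e (velocity γ τ) :=
  (hγ.eventually_mem_source hs).mono fun _ hτ => (hγ.hasDerivAt_chart_comp he hτ).deriv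

theorem IsGeodesic.eventuallyEq_deriv_chart_comp_apply
    (he : e ∈ IsManifold.maximalAtlas 𝓘(ℝ, Model d) ∞ M) {γ : ℝ → M} (hγ : IsGeodesic d γ)
    {s : ℝ} (hs : γ s ∈ e.source) (ρ : Fin d) :
    deriv (fun τ => e (γ τ) ρ) =ᶠ[𝓝 s] fun τ => vecCoord e (velocity γ τ) ρ :=
  (hγ.eventually_mem_source hs).mono fun _ hτ =>
    (hasDerivAt_coord (hγ.hasDerivAt_chart_comp he hτ) ρ).deriv

theorem IsGeodesic.differentiableAt_vecCoord_velocity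
    (he : e ∈ IsManifold.maximalAtlas 𝓘(ℝ, Model d) ∞ M) {γ : ℝ → M} (hγ : IsGeodesic d γ)
    {s : ℝ} (hs : γ s ∈ e.source) :
    DifferentiableAt ℝ (fun τ => vecCoord e (velocity γ τ)) s := by
  have hsmooth : ContDiffAt ℝ ∞ (fun τ => e (γ τ)) s := by
    rw [← contMDiffAt_iff_contDiffAt]
    exact (contMDiffAt_of_mem_maximalAtlas he hs).comp s hγ.1.contMDiffAt
  have hderiv : DifferentiableAt ℝ (deriv fun τ => e (γ τ)) s :=
    ((contDiffAt_infty.1 hsmooth 2).derivWithin (m := 1) (by norm_num)).differentiableAt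
      (by simp)
  exact hderiv.congr_of_eventuallyEq (hγ.eventuallyEq_deriv_chart_comp he hs).symm

theorem IsGeodesic.hasDerivAt_vecCoord_velocity
    (he : e ∈ IsManifold.maximalAtlas 𝓘(ℝ, Model d) ∞ M) {γ : ℝ → M} (hγ : IsGeodesic d γ)
    {s : ℝ} (hs : γ s ∈ e.source) :
    HasDerivAt (fun τ => vecCoord e (velocity γ τ))
      (-christoffelForm e (e (γ s)) (vecCoord e (velocity γ s)) (vecCoord e (velocity γ s))) s := by
  have hv := (hγ.differentiableAt_vecCoord_velocity he hs).hasDerivAt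
  refine hv.congr_deriv ?_
  ext ρ
  have hsecond : deriv (deriv fun τ => e (γ τ) ρ) s =
      deriv (fun τ => vecCoord e (velocity γ τ)) s ρ := by
    rw [(hγ.eventuallyEq_deriv_chart_comp_apply he hs ρ).deriv_eq]
    exact (hasDerivAt_coord hv ρ).deriv
  have hode := hγ.2 e he s hs ρ
  simp_rw [hsecond, (hγ.eventuallyEq_deriv_chart_comp_apply he hs _).eq_of_nhds] at hode
  rw [PiLp.neg_apply, christoffelForm_apply]
  linarith

theorem IsParallelCovector.hasDerivAt_momForm
    (he : e ∈ IsManifold.maximalAtlas 𝓘(ℝ, Model d) ∞ M) {c : ℝ → CotangentBundle d M}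
    (hc : IsParallelCovector c) {s : ℝ} (hs : (c s).proj ∈ e.source) {v : Model d}
    (hv : HasDerivAt (fun τ => e (c τ).proj) v s) :
    HasDerivAt (fun τ => momForm e (c τ))
      (LinearMap.toContinuousLinearMap
        ((momForm e (c s) : Model d →ₗ[ℝ] ℝ) ∘ₗ christoffelForm e (e (c s).proj) v)) s := by
  refine LeviCivitaPhase.hasDerivAt_momForm fun β => (hc e he s hs β).congr_deriv ?_
  simp only [(hasDerivAt_coord hv _).deriv, LinearMap.coe_toContinuousLinearMap',
    LinearMap.comp_apply, ContinuousLinearMap.coe_coe, momForm_apply, christoffelForm_apply,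
    PiLp.single_apply, mul_ite, mul_one, mul_zero, Finset.sum_ite_eq', Finset.mem_univ, if_true,
    Finset.mul_sum]
  rw [Finset.sum_comm]
  exact Finset.sum_congr rfl fun ρ _ => Finset.sum_congr rfl fun α _ => by ring

theorem IsParallelCovector.hasDerivAt_pairing {c : ℝ → CotangentBundle d M}
    (hc : IsParallelCovector c) (hγ : IsGeodesic d fun s => (c s).proj) (s : ℝ) :
    HasDerivAt (fun s => pairing (c s).2 (velocity (fun σ => (c σ).proj) s)) 0 s := by
  set e := chartAt (Model d) (c s).proj
  have he : e ∈ IsManifold.maximalAtlas 𝓘(ℝ, Model d) ∞ M := IsManifold.chart_mem_maximalAtlas _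
  have hs : (c s).proj ∈ e.source := mem_chart_source _ _
  have hpairing := (hc.hasDerivAt_momForm he hs (hγ.hasDerivAt_chart_comp he hs)).clm_apply
    (hγ.hasDerivAt_vecCoord_velocity he hs)
  refine (hpairing.congr_of_eventuallyEq ?_).congr_deriv ?_
  · filter_upwards [hγ.eventually_mem_source hs] with τ hτ
    exact pairing_eq_momForm he hτ _
  · simp only [LinearMap.coe_toContinuousLinearMap', LinearMap.comp_apply,
      ContinuousLinearMap.coe_coe, map_neg, add_neg_cancel]

theorem IsParallelCovector.integral_pairing {c : ℝ → CotangentBundle d M}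
    (hc : IsParallelCovector c) (hγ : IsGeodesic d fun s => (c s).proj) :
    ∫ s in (0 : ℝ)..1, pairing (c s).2 (velocity (fun σ => (c σ).proj) s) =
      pairing (c 0).2 (velocity (fun σ => (c σ).proj) 0) := by
  have hconst : ∀ s, pairing (c s).2 (velocity (fun σ => (c σ).proj) s) =
      pairing (c 0).2 (velocity (fun σ => (c σ).proj) 0) := fun s =>
    is_const_of_deriv_eq_zero (fun s => (hc.hasDerivAt_pairing hγ s).differentiableAt)
      (fun s => (hc.hasDerivAt_pairing hγ s).deriv) s 0
  simp only [hconst, intervalIntegral.integral_const, sub_zero, one_smul]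

theorem IsShortestGeodesic.dist_le [IsRiemannianManifold 𝓘(ℝ, Model d) M] {γ : ℝ → M} {z x : M}
    (hγ : IsShortestGeodesic d γ z x) {s : ℝ} (hs : s ∈ Set.Icc (0 : ℝ) 1) :
    dist (γ s) z ≤ dist x z := by
  rw [dist_comm (γ s), dist_comm x, ← ENNReal.ofReal_le_ofReal_iff dist_nonneg, ← edist_dist,
    ← edist_dist]
  calc edist z (γ s) = riemannianEDist 𝓘(ℝ, Model d) z (γ s) := IsRiemannianManifold.out _ _
    _ ≤ pathELength 𝓘(ℝ, Model d) γ 0 s :=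
        riemannianEDist_le_pathELength (hγ.1.1.of_le (by simp)).contMDiffOn hγ.2.1 rfl hs.1
    _ ≤ pathELength 𝓘(ℝ, Model d) γ 0 1 := pathELength_mono le_rfl hs.2
    _ = edist z x := hγ.2.2.2

variable [IsContMDiffRiemannianBundle 𝓘(ℝ, Model d) ∞ (Model d)
      (fun x : M => TangentSpace 𝓘(ℝ, Model d) x)]

theorem IsGeodesic.hasDerivAt_inner_velocity {γ : ℝ → M} (hγ : IsGeodesic d γ) (s : ℝ) :
    HasDerivAt (fun s => inner ℝ (velocity (d := d) γ s) (velocity (d := d) γ s)) 0 s := by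
  set e := chartAt (Model d) (γ s)
  have he : e ∈ IsManifold.maximalAtlas 𝓘(ℝ, Model d) ∞ M := IsManifold.chart_mem_maximalAtlas _
  have hs : γ s ∈ e.source := mem_chart_source _ _
  have hspeed := hasDerivAt_metricForm_self
    (fun α β => differentiableAt_gLow he (e.map_source hs) α β)
    (hγ.hasDerivAt_chart_comp he hs) (hγ.hasDerivAt_vecCoord_velocity he hs)
  refine (hspeed.congr_of_eventuallyEq ?_).congr_deriv ?_
  · filter_upwards [hγ.eventually_mem_source hs] with τ hτ
    exact inner_eq_metricForm he hτ _ _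
  · rw [map_neg, mul_neg, two_mul_metricForm_christoffelForm he (e.map_source hs)]
    ring

theorem IsGeodesic.norm_velocity_eq {γ : ℝ → M} (hγ : IsGeodesic d γ) (s s' : ℝ) :
    ‖(velocity γ s : TangentSpace 𝓘(ℝ, Model d) (γ s))‖ =
      ‖(velocity γ s' : TangentSpace 𝓘(ℝ, Model d) (γ s'))‖ := by
  have hconst := is_const_of_deriv_eq_zero
    (fun s => (hγ.hasDerivAt_inner_velocity s).differentiableAt)
    (fun s => (hγ.hasDerivAt_inner_velocity s).deriv) s s'
  simp only [real_inner_self_eq_norm_sq] at hconst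
  exact (sq_eq_sq₀ (norm_nonneg _) (norm_nonneg _)).1 hconst

theorem IsShortestGeodesic.norm_velocity {γ : ℝ → M} {z x : M}
    (hγ : IsShortestGeodesic d γ z x) (s : ℝ) :
    ‖(velocity γ s : TangentSpace 𝓘(ℝ, Model d) (γ s))‖ = dist x z := by
  have hspeed : ∀ τ, ‖mfderiv 𝓘(ℝ, ℝ) 𝓘(ℝ, Model d) γ τ (1 : ℝ)‖ₑ =
      ENNReal.ofReal ‖(velocity γ s : TangentSpace 𝓘(ℝ, Model d) (γ s))‖ := fun τ => by
    rw [← hγ.1.norm_velocity_eq τ s, ofReal_norm]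
    rfl
  have hlength := hγ.2.2.2
  rw [pathELength_eq_lintegral_mfderiv_Icc] at hlength
  replace hlength := (MeasureTheory.lintegral_congr fun τ => (hspeed τ).symm).trans hlength
  simp only [MeasureTheory.lintegral_const, MeasureTheory.Measure.restrict_apply_univ,
    Real.volume_Icc, sub_zero, ENNReal.ofReal_one, mul_one, edist_dist, dist_comm z x] at hlength
  exact (ENNReal.ofReal_eq_ofReal_iff (norm_nonneg _) dist_nonneg).1 hlength

end Geodesics

section TaylorUniqueness

open Asymptotics

variable {E F : Type*} [NormedAddCommGroup E] [NormedSpace ℝ E] [NormedAddCommGroup F]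
  [NormedSpace ℝ F]

theorem coeff_eq_zero_of_isLittleO_sq {p₀ p₁ p₂ : F}
    (h : (fun r : ℝ => p₀ + r • p₁ + r ^ 2 • p₂) =o[𝓝 0] fun r : ℝ => r ^ 2) :
    p₀ = 0 ∧ p₁ = 0 ∧ p₂ = 0 := by
  obtain rfl : p₀ = 0 := by
    have hp₀ : Tendsto (fun r : ℝ => p₀ + r • p₁ + r ^ 2 • p₂) (𝓝 0) (𝓝 p₀) :=
      Continuous.tendsto' (by fun_prop) _ _ (by simp)
    exact tendsto_nhds_unique hp₀
      (h.trans_tendsto (Continuous.tendsto' (by fun_prop) _ _ (by simp)))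
  obtain rfl : p₁ = 0 := by
    have hp₁ : HasDerivAt (fun r : ℝ => 0 + r • p₁ + r ^ 2 • p₂) p₁ 0 :=
      (((hasDerivAt_const (0 : ℝ) (0 : F)).add ((hasDerivAt_id (0 : ℝ)).smul_const p₁)).add
        (((hasDerivAt_id (0 : ℝ)).pow 2).smul_const p₂)).congr_deriv (by simp)
    refine hp₁.unique (hasDerivAt_iff_isLittleO.2 ?_)
    simpa using h.trans (isLittleO_pow_id one_lt_two)
  refine ⟨rfl, rfl, ?_⟩
  have hp₂ : Tendsto (fun r : ℝ => (r ^ 2)⁻¹ • (r ^ 2 • p₂)) (𝓝[≠] 0) (𝓝 0) := by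
    simpa using (h.mono nhdsWithin_le_nhds).tendsto_inv_smul_nhds_zero
  refine tendsto_nhds_unique (tendsto_const_nhds.congr' ?_) hp₂
  filter_upwards [self_mem_nhdsWithin] with r (hr : r ≠ 0)
  exact (inv_smul_smul₀ (pow_ne_zero 2 hr) p₂).symm

theorem taylor_two_isLittleO {f : E → F} {u : E} (hf : ContDiffAt ℝ 2 f u) :
    (fun w => f w - f u - fderiv ℝ f u (w - u) -
      (1 / 2 : ℝ) • fderiv ℝ (fderiv ℝ f) u (w - u) (w - u)) =o[𝓝 u] fun w => ‖w - u‖ ^ 2 := by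
  have hsymm : IsSymmSndFDerivAt ℝ f u := hf.isSymmSndFDerivAt (by simp)
  have hf' : HasFDerivAt (fderiv ℝ f) (fderiv ℝ (fderiv ℝ f) u) u :=
    ((hf.fderiv_right (m := 1) (by norm_num)).differentiableAt (by simp)).hasFDerivAt
  obtain ⟨r, hr, hball⟩ := Metric.eventually_nhds_iff_ball.1 (hf.eventually (by simp))
  have hrem : ∀ w ∈ Metric.ball u r, HasFDerivWithinAt
      (fun w => f w - fderiv ℝ f u (w - u) -
        (1 / 2 : ℝ) • fderiv ℝ (fderiv ℝ f) u (w - u) (w - u))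
      (fderiv ℝ f w - fderiv ℝ f u - fderiv ℝ (fderiv ℝ f) u (w - u)) (Metric.ball u r) w := by
    intro w hw
    have hsub : HasFDerivAt (fun w => w - u) (ContinuousLinearMap.id ℝ E) w :=
      (hasFDerivAt_id w).sub_const u
    have hquad := ((fderiv ℝ (fderiv ℝ f) u).hasFDerivAt.comp w hsub).clm_apply hsub
    have hfw := ((hball w hw).differentiableAt (by simp)).hasFDerivAt
    refine ((hfw.sub ((fderiv ℝ f u).hasFDerivAt.comp w hsub)).sub
      (hquad.const_smul (1 / 2 : ℝ))).hasFDerivWithinAt.congr_fderiv ?_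
    ext a
    have hswap := hsymm.eq a (w - u)
    simp only [map_sub, _root_.sub_apply] at hswap
    simp only [ContinuousLinearMap.comp_id, one_div, Function.comp_apply, map_sub, smul_add,
      _root_.sub_apply, _root_.add_apply, _root_.smul_apply, ContinuousLinearMap.flip_apply,
      hswap, ← add_smul, sub_right_inj]
    norm_num
  have hlittle := (convex_ball u r).isLittleO_pow_succ (n := 1) (Metric.mem_ball_self hr) hrem
    (by simpa using hf'.isLittleO.norm_right.mono nhdsWithin_le_nhds)
  rw [nhdsWithin_eq_nhds.2 (Metric.ball_mem_nhds _ hr)] at hlittle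
  simpa [sub_right_comm] using hlittle

theorem fderiv_eq_of_isLittleO_sq {f : E → F} {u : E} (hf : ContDiffAt ℝ 2 f u) {c : F}
    {ℓ : E →L[ℝ] F} {B : E →ₗ[ℝ] E →ₗ[ℝ] F} (hB : ∀ a b, B a b = B b a)
    (h : (fun w => f w - c - ℓ (w - u) - (1 / 2 : ℝ) • B (w - u) (w - u)) =o[𝓝 u]
      fun w => ‖w - u‖ ^ 2) :
    fderiv ℝ f u = ℓ ∧ ∀ a b, fderiv ℝ (fderiv ℝ f) u a b = B a b := by
  have hcoeff : ∀ a, f u - c = 0 ∧ fderiv ℝ f u a - ℓ a = 0 ∧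
      (1 / 2 : ℝ) • (fderiv ℝ (fderiv ℝ f) u a a - B a a) = 0 := by
    intro a
    apply coeff_eq_zero_of_isLittleO_sq
    have hline : Tendsto (fun r : ℝ => u + r • a) (𝓝 0) (𝓝 u) :=
      Continuous.tendsto' (by fun_prop) _ _ (by simp)
    have hnorm : (fun r : ℝ => ‖u + r • a - u‖ ^ 2) =O[𝓝 0] fun r : ℝ => r ^ 2 :=
      IsBigO.of_bound (‖a‖ ^ 2) (.of_forall fun r => by simp [norm_smul, mul_pow, mul_comm])
    refine (((h.sub (taylor_two_isLittleO hf)).comp_tendsto hline).trans_isBigO hnorm).congr_left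
      fun r => ?_
    simp only [Function.comp_apply, add_sub_cancel_left, map_smul, _root_.smul_apply, smul_smul,
      LinearMap.smul_apply, smul_sub]
    module
  refine ⟨ContinuousLinearMap.ext fun a => sub_eq_zero.1 (hcoeff a).2.1, fun a b => ?_⟩
  have hdiag : ∀ a, fderiv ℝ (fderiv ℝ f) u a a = B a a := fun a =>
    sub_eq_zero.1 ((smul_eq_zero.1 (hcoeff a).2.2).resolve_left (by norm_num))
  have hsymm : IsSymmSndFDerivAt ℝ f u := hf.isSymmSndFDerivAt (by simp)
  have hpolar := hdiag (a + b)
  simp only [map_add, _root_.add_apply, LinearMap.add_apply, hdiag, hsymm.eq b a, hB b a] at hpolar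
  have htwo : (2 : ℝ) • fderiv ℝ (fderiv ℝ f) u a b = (2 : ℝ) • B a b := by
    linear_combination (norm := module) hpolar
  exact smul_right_injective F (two_ne_zero (α := ℝ)) htwo

end TaylorUniqueness

section SecondOrderODE

variable {E F : Type*} [NormedAddCommGroup E] [NormedSpace ℝ E] [NormedAddCommGroup F]
  [NormedSpace ℝ F]

theorem norm_sub_zero_le_of_hasDerivAt {f f' : ℝ → E} {C : ℝ}
    (hf : ∀ s ∈ Set.Icc (0 : ℝ) 1, HasDerivAt f (f' s) s)
    (hC : ∀ s ∈ Set.Icc (0 : ℝ) 1, ‖f' s‖ ≤ C) {s : ℝ} (hs : s ∈ Set.Icc (0 : ℝ) 1) :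
    ‖f s - f 0‖ ≤ C := by
  have h0 : (0 : ℝ) ∈ Set.Icc (0 : ℝ) 1 := Set.left_mem_Icc.2 zero_le_one
  calc ‖f s - f 0‖ ≤ C * ‖s - 0‖ := (convex_Icc 0 1).norm_image_sub_le_of_norm_hasDerivWithin_le
        (fun τ hτ => (hf τ hτ).hasDerivWithinAt) hC h0 hs
    _ ≤ C := mul_le_of_le_one_right ((norm_nonneg _).trans (hC 0 h0))
        (by simpa [abs_of_nonneg hs.1] using hs.2)

theorem norm_taylor_two_le {k v a : ℝ → E} {C : ℝ}
    (hk : ∀ s ∈ Set.Icc (0 : ℝ) 1, HasDerivAt k (v s) s)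
    (hv : ∀ s ∈ Set.Icc (0 : ℝ) 1, HasDerivAt v (a s) s)
    (ha : ∀ s ∈ Set.Icc (0 : ℝ) 1, ‖a s - a 0‖ ≤ C) :
    ‖k 1 - k 0 - v 0 - (1 / 2 : ℝ) • a 0‖ ≤ C := by
  have hvel : ∀ s ∈ Set.Icc (0 : ℝ) 1, ‖v s - s • a 0 - v 0‖ ≤ C := fun s hs => by
    simpa using norm_sub_zero_le_of_hasDerivAt (f := fun s => v s - s • a 0)
      (f' := fun s => a s - a 0)
      (fun s hs => by simpa using (hv s hs).fun_sub ((hasDerivAt_id s).smul_const (a 0))) ha hs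
  have hpos := norm_sub_zero_le_of_hasDerivAt
    (f := fun s => k s - (s ^ 2 / 2) • a 0 - s • v 0) (f' := fun s => v s - s • a 0 - v 0)
    (fun s hs => by
      have hsq := (((hasDerivAt_id s).pow 2).div_const 2).smul_const (a 0)
      simpa using ((hk s hs).fun_sub hsq).fun_sub ((hasDerivAt_id s).smul_const (v 0)))
    hvel (Set.right_mem_Icc.2 zero_le_one)
  convert hpos using 2
  simp only [one_pow, one_smul, ne_eq, OfNat.ofNat_ne_zero, not_false_eq_true, zero_pow, zero_div,
    zero_smul, sub_zero]
  abel

theorem norm_diag_sub_diag_le {B : E →ₗ[ℝ] E →ₗ[ℝ] F} {K : ℝ}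
    (hB : ∀ a b, ‖B a b‖ ≤ K * ‖a‖ * ‖b‖) (a b : E) :
    ‖B a a - B b b‖ ≤ K * ‖a - b‖ * (‖a‖ + ‖b‖) := by
  calc ‖B a a - B b b‖ = ‖B (a - b) a + B b (a - b)‖ := by
        simp only [map_sub, LinearMap.sub_apply, sub_add_sub_cancel]
    _ ≤ K * ‖a - b‖ * ‖a‖ + K * ‖b‖ * ‖a - b‖ := norm_add_le_of_le (hB _ _) (hB _ _)
    _ = K * ‖a - b‖ * (‖a‖ + ‖b‖) := by ring

theorem norm_taylor_two_le_of_quadratic_ode {k v : ℝ → E} {A : ℝ → E →ₗ[ℝ] E →ₗ[ℝ] E}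
    {K δ D : ℝ} (hD : 0 ≤ D) (hk : ∀ s ∈ Set.Icc (0 : ℝ) 1, HasDerivAt k (v s) s)
    (hv : ∀ s ∈ Set.Icc (0 : ℝ) 1, HasDerivAt v (-A s (v s) (v s)) s)
    (hvD : ∀ s ∈ Set.Icc (0 : ℝ) 1, ‖v s‖ ≤ D)
    (hA : ∀ a b, ‖A 0 a b‖ ≤ K * ‖a‖ * ‖b‖)
    (hAδ : ∀ s ∈ Set.Icc (0 : ℝ) 1, ∀ a b, ‖A s a b - A 0 a b‖ ≤ δ * ‖a‖ * ‖b‖)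
    (hK : 0 ≤ K) (hδ : 0 ≤ δ) :
    ‖k 1 - k 0 - v 0 + (1 / 2 : ℝ) • A 0 (v 0) (v 0)‖ ≤ (δ + 2 * K * (K + δ) * D) * D ^ 2 := by
  have hacc : ∀ s ∈ Set.Icc (0 : ℝ) 1, ‖-A s (v s) (v s)‖ ≤ (K + δ) * D ^ 2 := fun s hs => by
    have hvs := hvD s hs
    calc ‖-A s (v s) (v s)‖ = ‖A 0 (v s) (v s) + (A s (v s) (v s) - A 0 (v s) (v s))‖ := by
          rw [norm_neg, add_sub_cancel]
      _ ≤ K * ‖v s‖ * ‖v s‖ + δ * ‖v s‖ * ‖v s‖ :=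
          norm_add_le_of_le (hA _ _) (hAδ s hs _ _)
      _ = (K + δ) * ‖v s‖ ^ 2 := by ring
      _ ≤ (K + δ) * D ^ 2 := by gcongr
  have h0 : (0 : ℝ) ∈ Set.Icc (0 : ℝ) 1 := Set.left_mem_Icc.2 zero_le_one
  have hosc : ∀ s ∈ Set.Icc (0 : ℝ) 1,
      ‖-A s (v s) (v s) - -A 0 (v 0) (v 0)‖ ≤ (δ + 2 * K * (K + δ) * D) * D ^ 2 := fun s hs => by
    have hvs := hvD s hs
    have hv0 := hvD 0 h0
    have hdiff := norm_sub_zero_le_of_hasDerivAt hv hacc hs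
    calc ‖-A s (v s) (v s) - -A 0 (v 0) (v 0)‖
        = ‖(A s (v s) (v s) - A 0 (v s) (v s)) + (A 0 (v s) (v s) - A 0 (v 0) (v 0))‖ := by
          rw [sub_add_sub_cancel, neg_sub_neg, norm_sub_rev]
      _ ≤ δ * ‖v s‖ * ‖v s‖ + K * ‖v s - v 0‖ * (‖v s‖ + ‖v 0‖) :=
          norm_add_le_of_le (hAδ s hs _ _) (norm_diag_sub_diag_le hA _ _)
      _ ≤ δ * D * D + K * ((K + δ) * D ^ 2) * (D + D) := by gcongr
      _ = (δ + 2 * K * (K + δ) * D) * D ^ 2 := by ring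
  simpa only [smul_neg, sub_neg_eq_add] using norm_taylor_two_le hk hv hosc

end SecondOrderODE

section QuadraticReparametrisation

open Asymptotics

variable {X E F : Type*} [NormedAddCommGroup E] [NormedSpace ℝ E] [NormedAddCommGroup F]
  [NormedSpace ℝ F] {l : Filter X} {v w : X → E} {D : X → ℝ} {G : E →ₗ[ℝ] E →ₗ[ℝ] E} {K : ℝ}

theorem isBigO_diag {B : E →ₗ[ℝ] E →ₗ[ℝ] F} (hB : ∀ a b, ‖B a b‖ ≤ K * ‖a‖ * ‖b‖)
    (hv : v =O[l] D) : (fun x => B (v x) (v x)) =O[l] fun x => D x ^ 2 := by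
  refine .trans (.of_bound K (.of_forall fun x => ?_)) (hv.norm_left.pow 2)
  simpa [sq, mul_assoc] using hB (v x) (v x)

theorem isBigO_sub_of_isLittleO_quadratic (hG : ∀ a b, ‖G a b‖ ≤ K * ‖a‖ * ‖b‖) (hv : v =O[l] D)
    (hw : (fun x => w x - v x + (1 / 2 : ℝ) • G (v x) (v x)) =o[l] fun x => D x ^ 2) :
    (fun x => v x - w x) =O[l] fun x => D x ^ 2 :=
  (((isBigO_diag hG hv).const_smul_left (1 / 2 : ℝ)).sub hw.isBigO).congr_left fun x => by
    simp only [Pi.smul_apply]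
    abel

theorem isLittleO_sub_of_isLittleO_quadratic (hG : ∀ a b, ‖G a b‖ ≤ K * ‖a‖ * ‖b‖)
    (hv : v =O[l] D) (hD : Tendsto D l (𝓝 0))
    (hw : (fun x => w x - v x + (1 / 2 : ℝ) • G (v x) (v x)) =o[l] fun x => D x ^ 2) :
    (fun x => v x - w x) =o[l] D := by
  refine (isBigO_sub_of_isLittleO_quadratic hG hv hw).trans_isLittleO ?_
  simpa [sq] using ((isLittleO_one_iff ℝ).2 hD).mul_isBigO (isBigO_refl D l)

theorem isBigO_of_isLittleO_quadratic (hG : ∀ a b, ‖G a b‖ ≤ K * ‖a‖ * ‖b‖) (hv : v =O[l] D)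
    (hDv : D =O[l] v) (hD : Tendsto D l (𝓝 0))
    (hw : (fun x => w x - v x + (1 / 2 : ℝ) • G (v x) (v x)) =o[l] fun x => D x ^ 2) :
    D =O[l] w := by
  have hsub := (isLittleO_sub_of_isLittleO_quadratic hG hv hD hw).trans_isBigO hDv
  exact hDv.trans (by simpa using hsub.right_isBigO_sub)

theorem isLittleO_diag_sub_diag {B : E →ₗ[ℝ] E →ₗ[ℝ] F} {K' : ℝ}
    (hB : ∀ a b, ‖B a b‖ ≤ K' * ‖a‖ * ‖b‖) (hG : ∀ a b, ‖G a b‖ ≤ K * ‖a‖ * ‖b‖)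
    (hv : v =O[l] D) (hD : Tendsto D l (𝓝 0))
    (hw : (fun x => w x - v x + (1 / 2 : ℝ) • G (v x) (v x)) =o[l] fun x => D x ^ 2) :
    (fun x => B (v x) (v x) - B (w x) (w x)) =o[l] fun x => D x ^ 2 := by
  have hsub := isLittleO_sub_of_isLittleO_quadratic hG hv hD hw
  have hw' : w =O[l] D := (hv.sub hsub.isBigO).congr_left fun x => by abel
  have hdiff : (fun x => B (v x) (v x) - B (w x) (w x)) =O[l]
      fun x => ‖v x - w x‖ * (‖v x‖ + ‖w x‖) := by
    refine .of_bound K' (.of_forall fun x => ?_)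
    simpa [abs_of_nonneg (add_nonneg (norm_nonneg (v x)) (norm_nonneg (w x))), mul_assoc] using
      norm_diag_sub_diag_le hB (v x) (w x)
  refine hdiff.trans_isLittleO ?_
  simpa only [sq] using hsub.norm_left.mul_isBigO (hv.norm_left.add hw'.norm_left)

end QuadraticReparametrisation

section ShortGeodesics

open Asymptotics

variable {d : ℕ} {M : Type*} [MetricSpace M] [ChartedSpace (Model d) M]
  [IsManifold 𝓘(ℝ, Model d) ∞ M]
  [RiemannianBundle (fun x : M => TangentSpace 𝓘(ℝ, Model d) x)]
  {e : OpenPartialHomeomorph M (Model d)} {z : M}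

theorem eventually_forall_shortestGeodesic [IsRiemannianManifold 𝓘(ℝ, Model d) M] {P : M → Prop}
    (hP : ∀ᶠ y in 𝓝 z, P y) :
    ∀ᶠ x in 𝓝 z, ∀ γ, IsShortestGeodesic d γ z x → ∀ s ∈ Set.Icc (0 : ℝ) 1, P (γ s) := by
  obtain ⟨r, hr, hball⟩ := Metric.eventually_nhds_iff_ball.1 hP
  filter_upwards [Metric.ball_mem_nhds z hr] with x hx γ hγ s hs
  exact hball _ ((hγ.dist_le hs).trans_lt hx)

variable [IsContMDiffRiemannianBundle 𝓘(ℝ, Model d) ∞ (Model d)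
      (fun x : M => TangentSpace 𝓘(ℝ, Model d) x)]

theorem exists_pos_eventually_le_metricForm (he : e ∈ IsManifold.maximalAtlas 𝓘(ℝ, Model d) ∞ M)
    {u : Model d} (hu : u ∈ e.target) :
    ∃ κ > 0, ∀ᶠ v in 𝓝 u, ∀ a, κ * ‖a‖ ^ 2 ≤ metricForm e v a a := by
  obtain ⟨κ, hκ, hmin⟩ := exists_pos_forall_le_metricForm he hu
  refine ⟨κ / 2, half_pos hκ, ?_⟩
  filter_upwards [eventually_norm_metricForm_sub_le he hu (half_pos hκ)] with v hv a
  have hclose := (abs_le.1 (hv a a)).1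
  linarith [hmin a]

theorem IsShortestGeodesic.metricForm_velocity
    (he : e ∈ IsManifold.maximalAtlas 𝓘(ℝ, Model d) ∞ M) {γ : ℝ → M} {x : M}
    (hγ : IsShortestGeodesic d γ z x) {s : ℝ} (hs : γ s ∈ e.source) :
    metricForm e (e (γ s)) (vecCoord e (velocity γ s)) (vecCoord e (velocity γ s)) =
      dist x z ^ 2 := by
  rw [← inner_eq_metricForm he hs, real_inner_self_eq_norm_sq, hγ.norm_velocity]

variable {γ : M → ℝ → M}

theorem isBigO_dist_velocity (he : e ∈ IsManifold.maximalAtlas 𝓘(ℝ, Model d) ∞ M)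
    (hz : z ∈ e.source) (hγ : ∀ᶠ x in 𝓝 z, IsShortestGeodesic d (γ x) z x) :
    (fun x => dist x z) =O[𝓝 z] fun x => vecCoord e (velocity (γ x) 0) := by
  obtain ⟨K, -, hK⟩ := exists_norm_metricForm_le e (e z)
  refine .of_bound (√K) ?_
  filter_upwards [hγ] with x hx
  have hspeed := hx.metricForm_velocity he (s := 0) (by rwa [hx.2.1])
  rw [congrArg e hx.2.1] at hspeed
  have hle : dist x z ^ 2 ≤ K * ‖vecCoord e (velocity (γ x) 0)‖ ^ 2 := by
    rw [← hspeed, sq, ← mul_assoc]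
    exact (Real.le_norm_self _).trans (hK _ _)
  rw [Real.norm_of_nonneg dist_nonneg]
  calc dist x z ≤ √(K * ‖vecCoord e (velocity (γ x) 0)‖ ^ 2) := Real.le_sqrt_of_sq_le hle
    _ = √K * ‖vecCoord e (velocity (γ x) 0)‖ := by
      rw [Real.sqrt_mul' _ (sq_nonneg _), Real.sqrt_sq (norm_nonneg _)]

variable [IsRiemannianManifold 𝓘(ℝ, Model d) M]

theorem exists_eventually_norm_velocity_le
    (he : e ∈ IsManifold.maximalAtlas 𝓘(ℝ, Model d) ∞ M) (hz : z ∈ e.source) :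
    ∃ C, 0 ≤ C ∧ ∀ᶠ x in 𝓝 z, ∀ γ, IsShortestGeodesic d γ z x → ∀ s ∈ Set.Icc (0 : ℝ) 1,
      ‖vecCoord e (velocity γ s)‖ ≤ C * dist x z := by
  obtain ⟨κ, hκ, hlower⟩ := exists_pos_eventually_le_metricForm he (e.map_source hz)
  refine ⟨(√κ)⁻¹, by positivity, ?_⟩
  filter_upwards [eventually_forall_shortestGeodesic (d := d) (e.open_source.eventually_mem hz),
    eventually_forall_shortestGeodesic (d := d) ((e.continuousAt hz).eventually hlower)]
    with x hsource hlow γ hγ s hs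
  have hle := hlow γ hγ s hs (vecCoord e (velocity γ s))
  rw [hγ.metricForm_velocity he (hsource γ hγ s hs)] at hle
  rw [le_inv_mul_iff₀ (Real.sqrt_pos.2 hκ)]
  refine abs_le_of_sq_le_sq' ?_ dist_nonneg |>.2
  rwa [mul_pow, Real.sq_sqrt hκ.le]

theorem isBigO_velocity_dist (he : e ∈ IsManifold.maximalAtlas 𝓘(ℝ, Model d) ∞ M)
    (hz : z ∈ e.source) (hγ : ∀ᶠ x in 𝓝 z, IsShortestGeodesic d (γ x) z x) :
    (fun x => vecCoord e (velocity (γ x) 0)) =O[𝓝 z] fun x => dist x z := by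
  obtain ⟨C, -, hC⟩ := exists_eventually_norm_velocity_le he hz
  refine .of_bound C ?_
  filter_upwards [hC, hγ] with x hx hγx
  simpa using hx _ hγx 0 (by simp)

theorem exists_eventually_norm_chart_expansion_le
    (he : e ∈ IsManifold.maximalAtlas 𝓘(ℝ, Model d) ∞ M) (hz : z ∈ e.source) :
    ∃ K C : ℝ, ∀ δ > 0, ∀ᶠ x in 𝓝 z, ∀ γ, IsShortestGeodesic d γ z x →
      ‖e x - e z - vecCoord e (velocity γ 0) + (1 / 2 : ℝ) • christoffelForm e (e z)
        (vecCoord e (velocity γ 0)) (vecCoord e (velocity γ 0))‖ ≤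
      (δ + 2 * K * (K + δ) * (C * dist x z)) * (C * dist x z) ^ 2 := by
  obtain ⟨C, hC, hspeed⟩ := exists_eventually_norm_velocity_le he hz
  obtain ⟨K, hK, hΓ⟩ := exists_norm_christoffelForm_le e (e z)
  refine ⟨K, C, fun δ hδ => ?_⟩
  filter_upwards [hspeed,
    eventually_forall_shortestGeodesic (d := d) (e.open_source.eventually_mem hz),
    eventually_forall_shortestGeodesic (d := d) ((e.continuousAt hz).eventually
      (eventually_norm_christoffelForm_sub_le he (e.map_source hz) hδ))]
    with x hspeedx hsource hclose γ hγ
  have hode := norm_taylor_two_le_of_quadratic_ode (k := fun s => e (γ s))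
    (v := fun s => vecCoord e (velocity γ s)) (A := fun s => christoffelForm e (e (γ s)))
    (mul_nonneg hC dist_nonneg)
    (fun s hs => hγ.1.hasDerivAt_chart_comp he (hsource γ hγ s hs))
    (fun s hs => hγ.1.hasDerivAt_vecCoord_velocity he (hsource γ hγ s hs))
    (hspeedx γ hγ) (by simpa only [hγ.2.1] using hΓ)
    (by simpa only [hγ.2.1] using hclose γ hγ) hK hδ.le
  simpa only [hγ.2.1, hγ.2.2.1] using hode

theorem isLittleO_chart_expansion (he : e ∈ IsManifold.maximalAtlas 𝓘(ℝ, Model d) ∞ M)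
    (hz : z ∈ e.source) (hγ : ∀ᶠ x in 𝓝 z, IsShortestGeodesic d (γ x) z x) :
    (fun x => e x - e z - vecCoord e (velocity (γ x) 0) + (1 / 2 : ℝ) • christoffelForm e (e z)
        (vecCoord e (velocity (γ x) 0)) (vecCoord e (velocity (γ x) 0))) =o[𝓝 z]
      fun x => dist x z ^ 2 := by
  obtain ⟨K, C, hexp⟩ := exists_eventually_norm_chart_expansion_le he hz
  refine isLittleO_iff.2 fun η hη => ?_
  set δ := η / (C ^ 2 + 1)
  have hδ : δ * C ^ 2 < η := by
    rw [div_mul_eq_mul_div, div_lt_iff₀ (by positivity)]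
    linarith
  have hcont : ContinuousAt (fun x => (δ + 2 * K * (K + δ) * (C * dist x z)) * C ^ 2) z := by
    fun_prop
  have hcoeff := hcont.eventually_lt_const (by simpa using hδ)
  filter_upwards [hexp δ (by positivity), hγ, hcoeff] with x hx hγx hη
  calc _ ≤ (δ + 2 * K * (K + δ) * (C * dist x z)) * (C * dist x z) ^ 2 := hx _ hγx
    _ = (δ + 2 * K * (K + δ) * (C * dist x z)) * C ^ 2 * dist x z ^ 2 := by ring
    _ ≤ η * ‖dist x z ^ 2‖ := by
      rw [Real.norm_of_nonneg (sq_nonneg _)]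
      gcongr

theorem isBigO_dist_sub_chart (he : e ∈ IsManifold.maximalAtlas 𝓘(ℝ, Model d) ∞ M)
    (hz : z ∈ e.source) (hγ : ∀ᶠ x in 𝓝 z, IsShortestGeodesic d (γ x) z x) :
    (fun x => dist x z) =O[𝓝 z] fun x => e x - e z := by
  obtain ⟨K, -, hΓ⟩ := exists_norm_christoffelForm_le e (e z)
  have hdist : Tendsto (fun x => dist x z) (𝓝 z) (𝓝 0) :=
    tendsto_iff_dist_tendsto_zero.1 tendsto_id
  exact isBigO_of_isLittleO_quadratic hΓ (isBigO_velocity_dist he hz hγ)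
    (isBigO_dist_velocity he hz hγ) hdist (isLittleO_chart_expansion he hz hγ)

end ShortGeodesics

section Smoothness

variable {d : ℕ} {M : Type*} [MetricSpace M] [ChartedSpace (Model d) M] {y : M}
  {η : Cotangent d y}

/-- The affine line `r ↦ η + r w` in the fibre of `T*M` over `y`. -/
noncomputable def fibreLine (η w : Cotangent d y) (r : ℝ) : CotangentBundle d M :=
  ⟨y, η + r • w⟩

@[simp]
theorem fibreLine_zero (η w : Cotangent d y) : fibreLine η w 0 = ⟨y, η⟩ := by
  simp [fibreLine]

theorem eventually_fibreLine_ne_zero (hη : η ≠ 0) (w : Cotangent d y) :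
    ∀ᶠ r in 𝓝 (0 : ℝ), (fibreLine η w r).2 ≠ 0 := by
  have hcont : Continuous fun r : ℝ => η + r • w := by fun_prop
  exact (hcont.continuousAt (x := 0)).eventually_ne (by simpa using hη)

variable [IsManifold 𝓘(ℝ, Model d) ∞ M]

theorem contMDiff_fibreLine (η w : Cotangent d y) :
    ContMDiff 𝓘(ℝ, ℝ) (𝓘(ℝ, Model d).prod 𝓘(ℝ, Model d →L[ℝ] ℝ)) ∞ (fibreLine η w) := by
  intro r₀
  refine (contMDiffAt_hom_bundle (fibreLine η w)).2 ⟨contMDiffAt_const, ?_⟩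
  simp only [fibreLine, ContinuousLinearMap.inCoordinates, ContinuousLinearMap.add_comp,
    ContinuousLinearMap.comp_add, ContinuousLinearMap.smul_comp, ContinuousLinearMap.comp_smul]
  rw [contMDiffAt_iff_contDiffAt]
  fun_prop

variable [RiemannianBundle (fun x : M => TangentSpace 𝓘(ℝ, Model d) x)]
  {e : OpenPartialHomeomorph M (Model d)}
  {Φ : ℝ → CotangentBundle d M → CotangentBundle d M} {ε : ℝ}
  {φ : ℝ → M → CotangentBundle d M → ℂ}

theorem IsLeviCivitaPhase.contDiffAt_fibreLine (hφ : IsLeviCivitaPhase Φ ε φ)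
    (he : e ∈ IsManifold.maximalAtlas 𝓘(ℝ, Model d) ∞ M) (hη : η ≠ 0) (w : Cotangent d y)
    (s : ℝ) {u : Model d} (hu : u ∈ e.target) :
    ContDiffAt ℝ ∞ (fun v : (ℝ × ℝ) × Model d => φ v.1.1 (e.symm v.2) (fibreLine η w v.1.2))
      ((s, 0), u) := by
  rw [← contMDiffAt_iff_contDiffAt]
  have htime : ContMDiffAt 𝓘(ℝ, (ℝ × ℝ) × Model d) 𝓘(ℝ, ℝ) ∞
      (fun v : (ℝ × ℝ) × Model d => v.1.1) ((s, 0), u) :=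
    contMDiffAt_iff_contDiffAt.2 (by fun_prop)
  have hpoint : ContMDiffAt 𝓘(ℝ, (ℝ × ℝ) × Model d) 𝓘(ℝ, Model d) ∞
      (fun v : (ℝ × ℝ) × Model d => e.symm v.2) ((s, 0), u) :=
    (contMDiffAt_symm_of_mem_maximalAtlas he hu).comp
      (g := e.symm) (f := fun v : (ℝ × ℝ) × Model d => v.2) ((s, 0), u)
      (contMDiffAt_iff_contDiffAt.2 contDiffAt_snd)
  have hmomentum : ContMDiffAt 𝓘(ℝ, (ℝ × ℝ) × Model d)
      (𝓘(ℝ, Model d).prod 𝓘(ℝ, Model d →L[ℝ] ℝ)) ∞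
      (fun v : (ℝ × ℝ) × Model d => fibreLine η w v.1.2) ((s, 0), u) :=
    (contMDiff_fibreLine η w).contMDiffAt.comp
      (f := fun v : (ℝ × ℝ) × Model d => v.1.2) ((s, 0), u)
      (contMDiffAt_iff_contDiffAt.2 (by fun_prop))
  have hne : ∀ᶠ v : (ℝ × ℝ) × Model d in 𝓝 ((s, 0), u), (fibreLine η w v.1.2).2 ≠ 0 := by
    have hcont : ContinuousAt (fun v : (ℝ × ℝ) × Model d => v.1.2) ((s, 0), u) := by fun_prop
    exact hcont.eventually (eventually_fibreLine_ne_zero hη w)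
  have hφline := (hφ.smooth (s, e.symm u, fibreLine η w 0) hne.self_of_nhds).comp
    (s := {v : (ℝ × ℝ) × Model d | (fibreLine η w v.1.2).2 ≠ 0})
    (f := fun v : (ℝ × ℝ) × Model d => (v.1.1, e.symm v.2, fibreLine η w v.1.2))
    ((s, 0), u) (htime.prodMk (hpoint.prodMk hmomentum)).contMDiffWithinAt (fun v hv => hv)
  exact hφline.contMDiffAt hne

theorem IsLeviCivitaPhase.contDiffAt_symm (hφ : IsLeviCivitaPhase Φ ε φ)
    (he : e ∈ IsManifold.maximalAtlas 𝓘(ℝ, Model d) ∞ M) {p : CotangentBundle d M}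
    (hp : p.2 ≠ 0) (t : ℝ) {u : Model d} (hu : u ∈ e.target) :
    ContDiffAt ℝ ∞ (fun v => φ t (e.symm v) p) u := by
  have hslice : ContDiffAt ℝ ∞ (fun v : Model d => (((t, (0 : ℝ)), v) : (ℝ × ℝ) × Model d)) u := by
    fun_prop
  simpa only [Function.comp_def, fibreLine_zero] using
    (hφ.contDiffAt_fibreLine he hp 0 t hu).comp u hslice

end Smoothness

section PhaseExpansion

open Asymptotics

variable {d : ℕ} {M : Type*} [MetricSpace M] [ChartedSpace (Model d) M]
  [RiemannianBundle (fun x : M => TangentSpace 𝓘(ℝ, Model d) x)]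
  {e : OpenPartialHomeomorph M (Model d)} {p : CotangentBundle d M}

/-- The bilinear form `Γ^ρ_{αβ}(x) ξ_ρ + i κ g_{αβ}(x)` attached to `p = (x, ξ)` in the chart `e`.
With `κ = ε h(y, η)` it is the Hessian of a Levi-Civita phase function at `(x, ξ) = (x*, ξ*)`. -/
noncomputable def phaseHessian (e : OpenPartialHomeomorph M (Model d)) (p : CotangentBundle d M)
    (κ : ℝ) : Model d →ₗ[ℝ] Model d →ₗ[ℝ] ℂ :=
  (christoffelForm e (e p.proj)).compr₂ (Complex.ofRealCLM.comp (momForm e p)) +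
    (metricForm e (e p.proj)).compr₂ (LinearMap.toSpanSingleton ℝ ℂ (Complex.I * κ))

theorem phaseHessian_apply (κ : ℝ) (a b : Model d) :
    phaseHessian e p κ a b = momForm e p (christoffelForm e (e p.proj) a b) +
      Complex.I * κ * metricForm e (e p.proj) a b := by
  simp [phaseHessian, mul_comm]

theorem phaseHessian_comm (κ : ℝ) (a b : Model d) :
    phaseHessian e p κ a b = phaseHessian e p κ b a := by
  simp only [phaseHessian_apply, christoffelForm_comm _ a b, metricForm_comm _ a b]

theorem im_phaseHessian (κ : ℝ) (a b : Model d) :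
    (phaseHessian e p κ a b).im = κ * metricForm e (e p.proj) a b := by
  simp [phaseHessian_apply]

variable [IsManifold 𝓘(ℝ, Model d) ∞ M]
  [IsContMDiffRiemannianBundle 𝓘(ℝ, Model d) ∞ (Model d)
      (fun x : M => TangentSpace 𝓘(ℝ, Model d) x)]
  {Φ : ℝ → CotangentBundle d M → CotangentBundle d M} {ε t : ℝ}
  {φ : ℝ → M → CotangentBundle d M → ℂ}

theorem IsLeviCivitaPhase.exists_shortestGeodesic_eq (hφ : IsLeviCivitaPhase Φ ε φ) (hp : p.2 ≠ 0)
    (he : e ∈ IsManifold.maximalAtlas 𝓘(ℝ, Model d) ∞ M) (hz : (Φ t p).proj ∈ e.source) :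
    ∃ γ : M → ℝ → M, ∀ᶠ x in 𝓝 (Φ t p).proj, IsShortestGeodesic d (γ x) (Φ t p).proj x ∧
      φ t x p = momForm e (Φ t p) (vecCoord e (velocity (γ x) 0)) +
        Complex.I * (ε * ham p : ℝ) / 2 * metricForm e (e (Φ t p).proj)
          (vecCoord e (velocity (γ x) 0)) (vecCoord e (velocity (γ x) 0)) := by
  obtain ⟨c, hc⟩ := (hφ.eq_near t p hp).choice
  refine ⟨fun x s => (c x s).proj, ?_⟩
  filter_upwards [hc] with x ⟨hγ, hc₀, hpar, hval⟩
  have hc₀z : (c x 0).proj ∈ e.source := by rwa [hc₀]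
  have hspeed := hγ.metricForm_velocity he hc₀z
  refine ⟨hγ, ?_⟩
  rw [hval, hpar.integral_pairing hγ.1, pairing_eq_momForm he hc₀z, ← hc₀]
  rw [← hc₀] at hspeed
  rw [hspeed]
  push_cast
  ring

variable [IsRiemannianManifold 𝓘(ℝ, Model d) M]

theorem IsLeviCivitaPhase.isLittleO_dist (hφ : IsLeviCivitaPhase Φ ε φ) (hp : p.2 ≠ 0)
    (he : e ∈ IsManifold.maximalAtlas 𝓘(ℝ, Model d) ∞ M) (hz : (Φ t p).proj ∈ e.source) :
    (fun x => φ t x p - momForm e (Φ t p) (e x - e (Φ t p).proj) -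
      (1 / 2 : ℝ) • phaseHessian e (Φ t p) (ε * ham p) (e x - e (Φ t p).proj)
        (e x - e (Φ t p).proj)) =o[𝓝 (Φ t p).proj]
      fun x => dist x (Φ t p).proj ^ 2 := by
  obtain ⟨γ, hγφ⟩ := hφ.exists_shortestGeodesic_eq hp he hz
  have hγ := hγφ.mono fun x hx => hx.1
  set z := (Φ t p).proj
  set H := phaseHessian e (Φ t p) (ε * ham p)
  have hexp := isLittleO_chart_expansion he hz hγ
  obtain ⟨K, -, hΓ⟩ := exists_norm_christoffelForm_le e (e z)
  have hdist : Tendsto (fun x => dist x z) (𝓝 z) (𝓝 0) := tendsto_iff_dist_tendsto_zero.1 tendsto_id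
  have hH := isLittleO_diag_sub_diag (B := H) (H.toContinuousBilinearMap.le_opNorm₂ ·)
    hΓ (isBigO_velocity_dist he hz hγ) hdist hexp
  have hξ := (Complex.ofRealCLM.comp (momForm e (Φ t p))).isBigO_comp _ _ |>.trans_isLittleO hexp
  refine ((hH.const_smul_left (1 / 2 : ℝ)).sub hξ).congr' ?_ .rfl
  filter_upwards [hγφ] with x hx
  rw [hx.2]
  simp only [H, phaseHessian_apply, ContinuousLinearMap.comp_apply, Complex.ofRealCLM_apply,
    map_add, map_sub, map_smul, LinearMap.sub_apply, Pi.smul_apply, Complex.real_smul]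
  push_cast
  ring

theorem IsLeviCivitaPhase.isLittleO_coord (hφ : IsLeviCivitaPhase Φ ε φ) (hp : p.2 ≠ 0)
    (he : e ∈ IsManifold.maximalAtlas 𝓘(ℝ, Model d) ∞ M) (hz : (Φ t p).proj ∈ e.source) :
    (fun w => φ t (e.symm w) p - momForm e (Φ t p) (w - e (Φ t p).proj) -
      (1 / 2 : ℝ) • phaseHessian e (Φ t p) (ε * ham p) (w - e (Φ t p).proj)
        (w - e (Φ t p).proj)) =o[𝓝 (e (Φ t p).proj)]
      fun w => ‖w - e (Φ t p).proj‖ ^ 2 := by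
  obtain ⟨γ, hγφ⟩ := hφ.exists_shortestGeodesic_eq hp he hz
  have hdist := (isBigO_dist_sub_chart he hz (hγφ.mono fun x hx => hx.1)).norm_right.pow 2
  have hcoord := ((hφ.isLittleO_dist hp he hz).trans_isBigO hdist).comp_tendsto (e.tendsto_symm hz)
  refine hcoord.congr' ?_ ?_ <;>
  · filter_upwards [e.eventually_right_inverse' hz] with w hw
    simp only [Function.comp_apply, hw]

theorem IsLeviCivitaPhase.fderiv_eq (hφ : IsLeviCivitaPhase Φ ε φ) (hp : p.2 ≠ 0)
    (he : e ∈ IsManifold.maximalAtlas 𝓘(ℝ, Model d) ∞ M) (hz : (Φ t p).proj ∈ e.source) :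
    fderiv ℝ (fun u => φ t (e.symm u) p) (e (Φ t p).proj) =
        Complex.ofRealCLM.comp (momForm e (Φ t p)) ∧
      ∀ a b, fderiv ℝ (fderiv ℝ fun u => φ t (e.symm u) p) (e (Φ t p).proj) a b =
        phaseHessian e (Φ t p) (ε * ham p) a b :=
  fderiv_eq_of_isLittleO_sq (c := 0)
    (contDiffAt_infty.1 (hφ.contDiffAt_symm he hp t (e.map_source hz)) 2) (phaseHessian_comm _)
    (by simpa using hφ.isLittleO_coord hp he hz)

end PhaseExpansion

section CriticalPoints

variable {E F P : Type*} [NormedAddCommGroup E] [NormedSpace ℝ E] [NormedAddCommGroup F]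
  [NormedSpace ℝ F] [NormedAddCommGroup P] [NormedSpace ℝ P]

theorem contDiffAt_partial_fderiv {G : P → E → F} {q : P} {u : E}
    (hG : ContDiffAt ℝ 2 (Function.uncurry G) (q, u)) :
    ContDiffAt ℝ 1 (fun v : P × E => fderiv ℝ (G v.1) v.2) (q, u) := by
  refine ContDiffAt.fderiv (n := 2) (f := fun v : P × E => G v.1) (g := Prod.snd) ?_
    contDiffAt_snd (by norm_num)
  exact hG.comp ((q, u), u) (f := fun v : (P × E) × E => (v.1.1, v.2)) (by fun_prop)

theorem hasDerivAt_along_curve {f : ℝ → E → F} {u : ℝ → E} {u' : E} {r : ℝ}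
    (hf : DifferentiableAt ℝ (Function.uncurry f) (r, u r)) (hu : HasDerivAt u u' r) :
    DifferentiableAt ℝ (fun s => f s (u r)) r ∧
      HasDerivAt (fun s => f s (u s))
        (deriv (fun s => f s (u r)) r + fderiv ℝ (f r) (u r) u') r := by
  set L := fderiv ℝ (Function.uncurry f) (r, u r)
  have htime : HasDerivAt (fun s => f s (u r)) (L (1, 0)) r :=
    hf.hasFDerivAt.comp_hasDerivAt (f := fun s => (s, u r)) r
      ((hasDerivAt_id r).prodMk (hasDerivAt_const r (u r)))
  have hspace : HasFDerivAt (f r) (L ∘L ContinuousLinearMap.inr ℝ ℝ E) (u r) :=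
    hf.hasFDerivAt.comp (f := fun w => (r, w)) (u r) (hasFDerivAt_prodMk_right r (u r))
  have hcurve : HasDerivAt (fun s => f s (u s)) (L (1, u')) r :=
    hf.hasFDerivAt.comp_hasDerivAt (f := fun s => (s, u s)) r ((hasDerivAt_id r).prodMk hu)
  refine ⟨htime.differentiableAt, hcurve.congr_deriv ?_⟩
  rw [htime.deriv, hspace.fderiv]
  simp [← map_add]

theorem fderiv_fderiv_clm_comp {F' : Type*} [NormedAddCommGroup F'] [NormedSpace ℝ F']
    (L : F →L[ℝ] F') {f : E → F} {u : E} (hf : ContDiffAt ℝ 2 f u) (a b : E) :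
    fderiv ℝ (fderiv ℝ fun w => L (f w)) u a b = L (fderiv ℝ (fderiv ℝ f) u a b) := by
  have hfirst : fderiv ℝ (fun w => L (f w)) =ᶠ[𝓝 u]
      fun w => ContinuousLinearMap.compL ℝ E F F' L (fderiv ℝ f w) := by
    filter_upwards [hf.eventually (by simp)] with w hw
    exact (L.hasFDerivAt.comp w (hw.differentiableAt (by simp)).hasFDerivAt).fderiv
  have hdiff : DifferentiableAt ℝ (fderiv ℝ f) u :=
    (hf.fderiv_right (m := 1) (by norm_num)).differentiableAt (by simp)
  have hsecond := (ContinuousLinearMap.compL ℝ E F F' L).hasFDerivAt.comp u hdiff.hasFDerivAt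
  rw [hfirst.fderiv_eq]
  exact DFunLike.congr_fun (DFunLike.congr_fun hsecond.fderiv a) b

theorem isInvertible_of_injective [FiniteDimensional ℝ E] [FiniteDimensional ℝ F]
    (hdim : Module.finrank ℝ E = Module.finrank ℝ F) {L : E →L[ℝ] F}
    (hL : Function.Injective L) : L.IsInvertible :=
  ⟨(LinearEquiv.ofInjectiveOfFinrankEq (L : E →ₗ[ℝ] F) hL hdim).toContinuousLinearEquiv,
    ContinuousLinearMap.ext fun _ => rfl⟩

theorem exists_critical_point_function [FiniteDimensional ℝ E] [CompleteSpace P]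
    {G : P → E → ℝ} {q₀ : P} {u₀ : E}
    (hG : ContDiffAt ℝ 2 (Function.uncurry G) (q₀, u₀)) (hcrit : fderiv ℝ (G q₀) u₀ = 0)
    (hinj : Function.Injective (fderiv ℝ (fderiv ℝ (G q₀)) u₀)) :
    ∃ ψ : P → E, ContDiffAt ℝ 1 ψ q₀ ∧
      ∀ᶠ v : P × E in 𝓝 (q₀, u₀), fderiv ℝ (G v.1) v.2 = 0 → ψ v.1 = v.2 := by
  have : CompleteSpace E := FiniteDimensional.complete ℝ E
  have hf := contDiffAt_partial_fderiv hG
  have hpartial : fderiv ℝ (fderiv ℝ (G q₀)) u₀ =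
      fderiv ℝ (fun v : P × E => fderiv ℝ (G v.1) v.2) (q₀, u₀) ∘L
        ContinuousLinearMap.inr ℝ P E :=
    ((hf.differentiableAt (by simp)).hasFDerivAt.comp (f := fun u => (q₀, u)) u₀
      (hasFDerivAt_prodMk_right q₀ u₀)).fderiv
  have hdim : Module.finrank ℝ E = Module.finrank ℝ (E →L[ℝ] ℝ) :=
    Subspace.dual_finrank_eq.symm.trans LinearMap.toContinuousLinearMap.finrank_eq
  have hinv := isInvertible_of_injective hdim (hpartial ▸ hinj)
  refine ⟨hf.implicitFunction (by simp) hinv, hf.contDiffAt_implicitFunction (by simp) hinv, ?_⟩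
  filter_upwards [hf.eventually_apply_eq_iff_implicitFunction (by simp) hinv] with v hv h₀
  exact hv.1 (h₀.trans hcrit.symm)

end CriticalPoints

section Propagation

variable {T R M : Type*} [TopologicalSpace T] [TopologicalSpace R] [TopologicalSpace M]
  [T2Space M]

theorem eqOn_of_mem_imp_eq {U : Set T} (hU : IsPreconnected U) {f g : T → M}
    (hf : ContinuousOn f U) (hg : ContinuousOn g U) {O : Set M} (hO : IsOpen O)
    (hgO : Set.MapsTo g U O) (h : ∀ s ∈ U, f s ∈ O → f s = g s) {s₁ : T} (hs₁ : s₁ ∈ U)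
    (hfs₁ : f s₁ ∈ O) : Set.EqOn f g U := by
  have : PreconnectedSpace U := isPreconnected_iff_preconnectedSpace.1 hU
  have hset : {s : U | f s = g s} = {s : U | f s ∈ O} :=
    Set.ext fun s => ⟨fun hs : f s = g s => show f s ∈ O from hs ▸ hgO s.2, h s s.2⟩
  have hclopen : IsClopen {s : U | f s = g s} :=
    ⟨isClosed_eq hf.domRestrict hg.domRestrict, hset ▸ hO.preimage hf.domRestrict⟩
  have huniv := hclopen.eq_univ ⟨⟨s₁, hs₁⟩, h s₁ hs₁ hfs₁⟩
  exact fun s hs => Set.eq_univ_iff_forall.1 huniv ⟨s, hs⟩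

theorem exists_nhds_forall_continuousAt [LocallyConnectedSpace T] {X : T → R → M} {s₀ : T} {r₀ : R}
    (hX : ∀ᶠ r in 𝓝 r₀, Continuous fun s => X s r) {Ψ : T × R → M}
    (hΨ : ∀ᶠ q in 𝓝 (s₀, r₀), ContinuousAt Ψ q)
    (h : ∀ᶠ v : (T × R) × M in 𝓝 ((s₀, r₀), X s₀ r₀), X v.1.1 v.1.2 = v.2 → Ψ v.1 = v.2) :
    ∃ U ∈ 𝓝 s₀, ∀ s₁ ∈ U, ContinuousAt (X s₁) r₀ → ∀ s ∈ U, ContinuousAt (X s) r₀ := by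
  obtain ⟨⟨Q, O⟩, ⟨hQ, hs₀O, hO⟩, hgraph⟩ :=
    ((𝓝 (s₀, r₀)).basis_sets.prod_nhds (nhds_basis_opens (X s₀ r₀))).eventually_iff.1 h
  have hΨ₀ : Ψ (s₀, r₀) = X s₀ r₀ := h.self_of_nhds rfl
  have hΨO : ∀ᶠ q in 𝓝 (s₀, r₀), Ψ q ∈ O :=
    hΨ.self_of_nhds.eventually (hO.mem_nhds (hΨ₀ ▸ hs₀O))
  obtain ⟨V, hV, W, hW, hVW⟩ := mem_nhds_prod_iff.1 (inter_mem hQ (hΨ.and hΨO))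
  have hXO : ∀ᶠ s in 𝓝 s₀, X s r₀ ∈ O :=
    hX.self_of_nhds.continuousAt.eventually (hO.mem_nhds hs₀O)
  obtain ⟨U, hU, hUconn, hUV⟩ := locallyConnectedSpace_iff_connected_subsets.1 ‹_› s₀ _
    (inter_mem hV hXO)
  refine ⟨U, hU, fun s₁ hs₁ hcont => ?_⟩
  have hmem : ∀ s ∈ U, ∀ r ∈ W, (s, r) ∈ Q ∩ {q | ContinuousAt Ψ q ∧ Ψ q ∈ O} :=
    fun s hs r hr => hVW ⟨(hUV hs).1, hr⟩
  have heq : ∀ᶠ r in 𝓝 r₀, Set.EqOn (fun s => X s r) (fun s => Ψ (s, r)) U := by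
    filter_upwards [hX, hW, hcont.eventually (hO.mem_nhds (hUV hs₁).2)] with r hXr hr hs₁O
    exact eqOn_of_mem_imp_eq hUconn hXr.continuousOn
      (fun s hs => ((hmem s hs r hr).2.1.comp (f := fun s => (s, r))
        (by fun_prop)).continuousWithinAt)
      hO (fun s hs => (hmem s hs r hr).2.2)
      (fun s hs hsO => (hgraph (x := ((s, r), X s r)) ⟨(hmem s hs r hr).1, hsO⟩ rfl).symm)
      hs₁ hs₁O
  intro s hs
  have hsΨ : (fun r => X s r) =ᶠ[𝓝 r₀] fun r => Ψ (s, r) := heq.mono fun r hr => hr hs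
  have hΨs : ContinuousAt Ψ (s, r₀) := (hmem s hs r₀ (mem_of_mem_nhds hW)).2.1
  exact (hΨs.comp (f := fun r => (s, r)) (by fun_prop)).congr hsΨ.symm

theorem continuousAt_of_locally_mem_graph [PreconnectedSpace T] [LocallyConnectedSpace T]
    {X : T → R → M} {r₀ : R} (hX : ∀ᶠ r in 𝓝 r₀, Continuous fun s => X s r)
    (h : ∀ s₀, ∃ Ψ : T × R → M, (∀ᶠ q in 𝓝 (s₀, r₀), ContinuousAt Ψ q) ∧
      ∀ᶠ v : (T × R) × M in 𝓝 ((s₀, r₀), X s₀ r₀), X v.1.1 v.1.2 = v.2 → Ψ v.1 = v.2)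
    {s₁ : T} (hs₁ : ContinuousAt (X s₁) r₀) (s : T) : ContinuousAt (X s) r₀ := by
  refine PreconnectedSpace.induction₂'
    (fun s s' => ContinuousAt (X s) r₀ → ContinuousAt (X s') r₀) (fun s₀ => ?_)
    ⟨fun _ _ _ hab hbc => hbc ∘ hab⟩ s₁ s hs₁
  obtain ⟨Ψ, hΨ, hgraph⟩ := h s₀
  obtain ⟨U, hU, hprop⟩ := exists_nhds_forall_continuousAt hX hΨ hgraph
  filter_upwards [hU] with s hs
  exact ⟨fun hc => hprop s₀ (mem_of_mem_nhds hU) hc s hs,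
    fun hc => hprop s hs hc s₀ (mem_of_mem_nhds hU)⟩

end Propagation

section Flow

variable {d : ℕ} {M : Type*} [MetricSpace M] [ChartedSpace (Model d) M]
  [IsManifold 𝓘(ℝ, Model d) ∞ M]
  [RiemannianBundle (fun x : M => TangentSpace 𝓘(ℝ, Model d) x)]
  [IsContMDiffRiemannianBundle 𝓘(ℝ, Model d) ∞ (Model d)
      (fun x : M => TangentSpace 𝓘(ℝ, Model d) x)]
  [IsRiemannianManifold 𝓘(ℝ, Model d) M]
  {e : OpenPartialHomeomorph M (Model d)}
  {Φ : ℝ → CotangentBundle d M → CotangentBundle d M} {ε t : ℝ}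
  {φ : ℝ → M → CotangentBundle d M → ℂ}

theorem IsLeviCivitaPhase.fderiv_im_eq_zero (hφ : IsLeviCivitaPhase Φ ε φ)
    {p : CotangentBundle d M} (hp : p.2 ≠ 0)
    (he : e ∈ IsManifold.maximalAtlas 𝓘(ℝ, Model d) ∞ M) (hz : (Φ t p).proj ∈ e.source) :
    fderiv ℝ (fun u => (φ t (e.symm u) p).im) (e (Φ t p).proj) = 0 := by
  have hdiff := (hφ.contDiffAt_symm he hp t (e.map_source hz)).differentiableAt (by simp)
  refine (Complex.imCLM.hasFDerivAt.comp _ hdiff.hasFDerivAt).fderiv.trans ?_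
  rw [(hφ.fderiv_eq hp he hz).1]
  ext a
  simp

theorem IsLeviCivitaPhase.injective_fderiv_fderiv_im (hφ : IsLeviCivitaPhase Φ ε φ) (hε : ε ≠ 0)
    {p : CotangentBundle d M} (hp : p.2 ≠ 0)
    (he : e ∈ IsManifold.maximalAtlas 𝓘(ℝ, Model d) ∞ M) (hz : (Φ t p).proj ∈ e.source) :
    Function.Injective
      (fderiv ℝ (fderiv ℝ fun u => (φ t (e.symm u) p).im) (e (Φ t p).proj)) := by
  have hC2 := contDiffAt_infty.1 (hφ.contDiffAt_symm he hp t (e.map_source hz)) 2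
  rw [injective_iff_map_eq_zero]
  intro b hb
  have hbb : ε * ham p * metricForm e (e (Φ t p).proj) b b = 0 := by
    rw [← im_phaseHessian, ← (hφ.fderiv_eq hp he hz).2, ← Complex.imCLM_apply,
      ← fderiv_fderiv_clm_comp Complex.imCLM hC2]
    exact DFunLike.congr_fun hb b
  by_contra hb₀
  exact mul_ne_zero (mul_ne_zero hε (ham_pos hp).ne')
    (metricForm_pos he (e.map_source hz) hb₀).ne' hbb

variable {y : M} {η : Cotangent d y}

theorem IsLeviCivitaPhase.exists_contDiffAt_mem_graph (hφ : IsLeviCivitaPhase Φ ε φ) (hε : ε ≠ 0)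
    (he : e ∈ IsManifold.maximalAtlas 𝓘(ℝ, Model d) ∞ M) (hη : η ≠ 0) (w : Cotangent d y)
    (hs : (Φ t ⟨y, η⟩).proj ∈ e.source) :
    ∃ ψ : ℝ × ℝ → Model d, ContDiffAt ℝ 1 ψ (t, 0) ∧
      ∀ᶠ v : (ℝ × ℝ) × M in 𝓝 ((t, 0), (Φ t (fibreLine η w 0)).proj),
        (Φ v.1.1 (fibreLine η w v.1.2)).proj = v.2 → ψ v.1 = e v.2 := by
  rw [← fibreLine_zero η w] at hs
  have hne := eventually_fibreLine_ne_zero hη w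
  obtain ⟨ψ, hψ, hcrit⟩ := exists_critical_point_function
    (G := fun (q : ℝ × ℝ) u => (φ q.1 (e.symm u) (fibreLine η w q.2)).im)
    (q₀ := (t, 0)) (u₀ := e (Φ t (fibreLine η w 0)).proj)
    (Complex.imCLM.contDiff.contDiffAt.comp _
      (contDiffAt_infty.1 (hφ.contDiffAt_fibreLine he hη w t (e.map_source hs)) 2))
    (hφ.fderiv_im_eq_zero hne.self_of_nhds he hs)
    (hφ.injective_fderiv_fderiv_im hε hne.self_of_nhds he hs)
  refine ⟨ψ, hψ, ?_⟩
  have hcoord : Tendsto (fun v : (ℝ × ℝ) × M => (v.1, e v.2))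
      (𝓝 ((t, 0), (Φ t (fibreLine η w 0)).proj))
      (𝓝 ((t, 0), e (Φ t (fibreLine η w 0)).proj)) :=
    continuousAt_fst.prodMk ((e.continuousAt hs).tendsto.comp continuousAt_snd)
  have hparam : Tendsto (fun v : (ℝ × ℝ) × M => v.1.2)
      (𝓝 ((t, 0), (Φ t (fibreLine η w 0)).proj)) (𝓝 0) := continuous_fst.snd.tendsto' _ _ rfl
  filter_upwards [hcoord.eventually hcrit, hparam.eventually hne,
    continuousAt_snd.eventually (e.open_source.mem_nhds hs)] with v hv hvne hvs hvx
  apply hv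
  rw [← hvx] at hvs ⊢
  exact hφ.fderiv_im_eq_zero hvne he hvs

theorem IsLeviCivitaPhase.continuousAt_proj (hφ : IsLeviCivitaPhase Φ ε φ) (hε : ε ≠ 0)
    (hΦ : ∀ p, p.2 ≠ 0 → Continuous fun s => (Φ s p).proj)
    (hΦ₀ : ∀ p, p.2 ≠ 0 → (Φ 0 p).proj = p.proj) (hη : η ≠ 0) (w : Cotangent d y) (t : ℝ) :
    ContinuousAt (fun r => (Φ t (fibreLine η w r)).proj) 0 := by
  have hne := eventually_fibreLine_ne_zero hη w
  have hstart : ContinuousAt (fun r => (Φ 0 (fibreLine η w r)).proj) 0 :=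
    continuousAt_const.congr (hne.mono fun r hr => (hΦ₀ _ hr).symm)
  refine continuousAt_of_locally_mem_graph (X := fun s r => (Φ s (fibreLine η w r)).proj)
    (hne.mono fun r hr => hΦ _ hr) (fun s => ?_) hstart t
  set e := chartAt (Model d) (Φ s ⟨y, η⟩).proj
  have hs : (Φ s ⟨y, η⟩).proj ∈ e.source := mem_chart_source _ _
  obtain ⟨ψ, hψ, hgraph⟩ := hφ.exists_contDiffAt_mem_graph hε
    (IsManifold.chart_mem_maximalAtlas _) hη w hs
  rw [← fibreLine_zero η w] at hs
  have hψ₀ : ψ (s, 0) = e (Φ s (fibreLine η w 0)).proj := hgraph.self_of_nhds rfl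
  have htarget : ∀ᶠ q in 𝓝 (s, (0 : ℝ)), ψ q ∈ e.target :=
    hψ.continuousAt.eventually (e.open_target.mem_nhds (hψ₀ ▸ e.map_source hs))
  refine ⟨e.symm ∘ ψ, ?_, ?_⟩
  · filter_upwards [htarget, hψ.eventually (by simp)] with q hq hψq
    exact (e.continuousAt_symm hq).comp hψq.continuousAt
  · filter_upwards [hgraph, continuousAt_snd.eventually (e.open_source.mem_nhds hs)] with v hv hvs
    exact fun hvx => (congrArg e.symm (hv hvx)).trans (e.left_inv hvs)

theorem IsLeviCivitaPhase.differentiableAt_chart_proj (hφ : IsLeviCivitaPhase Φ ε φ) (hε : ε ≠ 0)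
    (hΦ : ∀ p, p.2 ≠ 0 → Continuous fun s => (Φ s p).proj)
    (hΦ₀ : ∀ p, p.2 ≠ 0 → (Φ 0 p).proj = p.proj)
    (he : e ∈ IsManifold.maximalAtlas 𝓘(ℝ, Model d) ∞ M) (hη : η ≠ 0) (w : Cotangent d y)
    (hz : (Φ t ⟨y, η⟩).proj ∈ e.source) :
    DifferentiableAt ℝ (fun r => e (Φ t (fibreLine η w r)).proj) 0 := by
  obtain ⟨ψ, hψ, hgraph⟩ := hφ.exists_contDiffAt_mem_graph hε he hη w hz
  have hgraph_curve : Tendsto (fun r => ((t, r), (Φ t (fibreLine η w r)).proj)) (𝓝 0)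
      (𝓝 ((t, 0), (Φ t (fibreLine η w 0)).proj)) :=
    (Continuous.prodMk_right t).continuousAt.prodMk (hφ.continuousAt_proj hε hΦ hΦ₀ hη w t)
  have hψt : DifferentiableAt ℝ (fun r => ψ (t, r)) 0 :=
    (hψ.differentiableAt (by simp)).comp (f := fun r => (t, r)) (0 : ℝ) (by fun_prop)
  exact hψt.congr_of_eventuallyEq ((hgraph_curve.eventually hgraph).mono fun r hr => (hr rfl).symm)

theorem IsLeviCivitaPhase.hasDerivAt_fderiv_fibreLine (hφ : IsLeviCivitaPhase Φ ε φ)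
    (he : e ∈ IsManifold.maximalAtlas 𝓘(ℝ, Model d) ∞ M) (hη : η ≠ 0) (w : Cotangent d y)
    (hz : (Φ t ⟨y, η⟩).proj ∈ e.source)
    (hcont : ContinuousAt (fun r => (Φ t (fibreLine η w r)).proj) 0) {x' : Model d}
    (hx' : HasDerivAt (fun r => e (Φ t (fibreLine η w r)).proj) x' 0) (a : Model d) :
    DifferentiableAt ℝ (fun r => momForm e (Φ t (fibreLine η w r)) a) 0 ∧
      HasDerivAt
        (fun r => fderiv ℝ (fun u => φ t (e.symm u) (fibreLine η w r)) (e (Φ t ⟨y, η⟩).proj) a)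
        (deriv (fun r => momForm e (Φ t (fibreLine η w r)) a) 0 -
          phaseHessian e (Φ t ⟨y, η⟩) (ε * ham (⟨y, η⟩ : CotangentBundle d M)) a x') 0 := by
  rw [← fibreLine_zero η w] at hz ⊢
  set u := fun r => e (Φ t (fibreLine η w r)).proj
  set G := fun r u => φ t (e.symm u) (fibreLine η w r)
  have hne := eventually_fibreLine_ne_zero hη w
  have hG : ContDiffAt ℝ 2 (Function.uncurry G) (0, u 0) :=
    (contDiffAt_infty.1 (hφ.contDiffAt_fibreLine he hη w t (e.map_source hz)) 2).comp
      (f := fun v : ℝ × Model d => ((t, v.1), v.2)) (0, u 0) (by fun_prop)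
  obtain ⟨hfixed, hcurve⟩ := hasDerivAt_along_curve (f := fun r => fderiv ℝ (G r))
    ((contDiffAt_partial_fderiv hG).differentiableAt (by simp)) hx'
  have hφx : (fun r => fderiv ℝ (G r) (u r) a) =ᶠ[𝓝 0]
      fun r => (momForm e (Φ t (fibreLine η w r)) a : ℂ) := by
    filter_upwards [hne, hcont.eventually (e.open_source.mem_nhds hz)] with r hr hrz
    exact DFunLike.congr_fun (hφ.fderiv_eq hr he hrz).1 a
  have hfixed_a := hfixed.hasDerivAt.clm_apply (hasDerivAt_const (0 : ℝ) a)
  have hcurve_a := (hcurve.clm_apply (hasDerivAt_const (0 : ℝ) a)).congr_of_eventuallyEq hφx.symm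
  have hmom : DifferentiableAt ℝ (fun r => momForm e (Φ t (fibreLine η w r)) a) 0 :=
    (Complex.reCLM.hasFDerivAt.comp_hasDerivAt (0 : ℝ) hcurve_a).differentiableAt
  refine ⟨hmom, hfixed_a.congr_deriv ?_⟩
  have hderiv := hmom.hasDerivAt.ofReal_comp.unique hcurve_a
  rw [hderiv, phaseHessian_comm, ← (hφ.fderiv_eq hne.self_of_nhds he hz).2]
  simp [G, u]

theorem IsLeviCivitaPhase.hasLineDerivAt_phiX (hφ : IsLeviCivitaPhase Φ ε φ)
    (he : e ∈ IsManifold.maximalAtlas 𝓘(ℝ, Model d) ∞ M) (hη : η ≠ 0) (w : Cotangent d y)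
    (hz : (Φ t ⟨y, η⟩).proj ∈ e.source)
    (hcont : ContinuousAt (fun r => (Φ t (fibreLine η w r)).proj) 0) {x' : Model d}
    (hx' : HasDerivAt (fun r => e (Φ t (fibreLine η w r)).proj) x' 0) (α : Fin d) :
    LineDifferentiableAt ℝ (xiStar e Φ t y α) η w ∧
      HasLineDerivAt ℝ (phiX e φ t y α (e (Φ t ⟨y, η⟩).proj))
        (lineDeriv ℝ (xiStar e Φ t y α) η w - phaseHessian e (Φ t ⟨y, η⟩)
          (ε * ham (⟨y, η⟩ : CotangentBundle d M)) (EuclideanSpace.single α 1) x') η w := by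
  have hderiv := hφ.hasDerivAt_fderiv_fibreLine he hη w hz hcont hx' (EuclideanSpace.single α 1)
  simp only [momForm_single] at hderiv
  refine ⟨hderiv.1, hderiv.2.congr_of_eventuallyEq ?_⟩
  filter_upwards [eventually_fibreLine_ne_zero hη w] with r hr
  exact ((hφ.contDiffAt_symm he hr t (e.map_source hz)).differentiableAt
    (by simp)).lineDeriv_eq_fderiv

end Flow

section Components

variable {d : ℕ} {M : Type*} [MetricSpace M] [ChartedSpace (Model d) M]
  [RiemannianBundle (fun x : M => TangentSpace 𝓘(ℝ, Model d) x)]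
  {e : OpenPartialHomeomorph M (Model d)}

theorem metricForm_single_left (u b : Model d) (α : Fin d) :
    metricForm e u (EuclideanSpace.single α 1) b = ∑ β, gLow e u α β * b β := by
  rw [metricForm_apply, Finset.sum_eq_single α (fun γ _ hγ => by simp [hγ]) (by simp)]
  simp

theorem christoffelForm_single_left (u b : Model d) (α ρ : Fin d) :
    christoffelForm e u (EuclideanSpace.single α 1) b ρ = ∑ β, christoffel e u ρ α β * b β := by
  rw [christoffelForm_apply, Finset.sum_eq_single α (fun γ _ hγ => by simp [hγ]) (by simp)]
  simp

/-- The components `g^{βγ}(x*) [∂_w ξ*_γ - Γ^ρ_{γσ}(x*) ξ*_ρ ∂_w (x*)^σ]`, where `∂_w` is the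
derivative in the direction `w ∈ T*_y M` of functions of `η`. For `w = dy^μ` this is `p^{βμ}`. -/
noncomputable def covDerivXiStar (e : OpenPartialHomeomorph M (Model d))
    (Φ : ℝ → CotangentBundle d M → CotangentBundle d M) (t : ℝ) {y : M} (η w : Cotangent d y)
    (β : Fin d) : ℝ :=
  ∑ γ, gUp e (e (Φ t ⟨y, η⟩).proj) β γ *
    (lineDeriv ℝ (xiStar e Φ t y γ) η w -
      ∑ ρ, ∑ σ, christoffel e (e (Φ t ⟨y, η⟩).proj) ρ γ σ * xiStar e Φ t y ρ η *
        lineDeriv ℝ (xStar e Φ t y σ) η w)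

variable {Φ : ℝ → CotangentBundle d M → CotangentBundle d M} {t : ℝ} {y : M} {η w : Cotangent d y}

theorem sum_gLow_mul_covDerivXiStar (he : e ∈ IsManifold.maximalAtlas 𝓘(ℝ, Model d) ∞ M)
    (hz : (Φ t ⟨y, η⟩).proj ∈ e.source) {x' : Model d}
    (hx' : ∀ σ, lineDeriv ℝ (xStar e Φ t y σ) η w = x' σ) (α : Fin d) :
    ∑ β, gLow e (e (Φ t ⟨y, η⟩).proj) α β * covDerivXiStar e Φ t η w β =
      lineDeriv ℝ (xiStar e Φ t y α) η w - momForm e (Φ t ⟨y, η⟩)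
        (christoffelForm e (e (Φ t ⟨y, η⟩).proj) (EuclideanSpace.single α 1) x') := by
  refine (congrFun (gLow_mulVec_gUp_mulVec he (e.map_source hz) _) α).trans ?_
  simp only [hx', momForm_apply, christoffelForm_single_left, Finset.mul_sum, xiStar]
  exact congrArg _ (Finset.sum_congr rfl fun ρ _ => Finset.sum_congr rfl fun σ _ => by ring)

theorem lineDeriv_xiStar_sub_phaseHessian (he : e ∈ IsManifold.maximalAtlas 𝓘(ℝ, Model d) ∞ M)
    (hz : (Φ t ⟨y, η⟩).proj ∈ e.source) {x' : Model d}
    (hx' : ∀ σ, lineDeriv ℝ (xStar e Φ t y σ) η w = x' σ) (κ : ℝ) (α : Fin d) :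
    lineDeriv ℝ (xiStar e Φ t y α) η w -
        phaseHessian e (Φ t ⟨y, η⟩) κ (EuclideanSpace.single α 1) x' =
      ∑ β, (gLow e (e (Φ t ⟨y, η⟩).proj) α β : ℂ) *
        (covDerivXiStar e Φ t η w β - Complex.I * κ * lineDeriv ℝ (xStar e Φ t y β) η w) := by
  have hcov := congrArg Complex.ofReal (sum_gLow_mul_covDerivXiStar he hz hx' α)
  push_cast at hcov
  simp only [mul_sub, Finset.sum_sub_distrib, hcov, phaseHessian_apply, metricForm_single_left,
    hx', Complex.ofReal_sum, Complex.ofReal_mul, Finset.mul_sum, sub_sub]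
  exact congrArg _ (congrArg _ (Finset.sum_congr rfl fun β _ => by ring))

end Components

end LeviCivitaPhase

open LeviCivitaPhase in
theorem theorem10p2_general {d : ℕ} {M : Type*} [MetricSpace M] [ChartedSpace (Model d) M]
    [IsManifold 𝓘(ℝ, Model d) ∞ M]
    [RiemannianBundle (fun x : M => TangentSpace 𝓘(ℝ, Model d) x)]
    [IsContMDiffRiemannianBundle 𝓘(ℝ, Model d) ∞ (Model d)
      (fun x : M => TangentSpace 𝓘(ℝ, Model d) x)]
    [IsRiemannianManifold 𝓘(ℝ, Model d) M]
    {Φ : ℝ → CotangentBundle d M → CotangentBundle d M}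
    (hΦ : ∀ p, p.2 ≠ 0 → Continuous fun s => (Φ s p).proj)
    (hΦ₀ : ∀ p, p.2 ≠ 0 → (Φ 0 p).proj = p.proj)
    {ε : ℝ} (hε : ε ≠ 0) {φ : ℝ → M → CotangentBundle d M → ℂ} (hφ : IsLeviCivitaPhase Φ ε φ)
    {t : ℝ} {y : M} {η : Cotangent d y} (hη : η ≠ 0) (w : Cotangent d y)
    {e : OpenPartialHomeomorph M (Model d)}
    (he : e ∈ IsManifold.maximalAtlas 𝓘(ℝ, Model d) ∞ M)
    (hz : (Φ t ⟨y, η⟩).proj ∈ e.source) (α : Fin d) :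
    (∀ β, LineDifferentiableAt ℝ (xStar e Φ t y β) η w ∧
      LineDifferentiableAt ℝ (xiStar e Φ t y β) η w) ∧
    HasLineDerivAt ℝ (phiX e φ t y α (e (Φ t ⟨y, η⟩).proj))
      (∑ β, (gLow e (e (Φ t ⟨y, η⟩).proj) α β : ℂ) *
        (covDerivXiStar e Φ t η w β - Complex.I * ε * ham (⟨y, η⟩ : CotangentBundle d M) *
          lineDeriv ℝ (xStar e Φ t y β) η w)) η w := by
  have hcont := hφ.continuousAt_proj hε hΦ hΦ₀ hη w t
  have hx' := (hφ.differentiableAt_chart_proj hε hΦ hΦ₀ he hη w hz).hasDerivAt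
  have hx (β) : HasLineDerivAt ℝ (xStar e Φ t y β) _ η w := hasDerivAt_coord hx' β
  have hφx := hφ.hasLineDerivAt_phiX he hη w hz hcont hx'
  refine ⟨fun β => ⟨(hx β).lineDifferentiableAt, (hφx β).1⟩, ?_⟩
  simpa only [lineDeriv_xiStar_sub_phaseHessian he hz fun β => (hx β).lineDeriv,
    Complex.ofReal_mul, mul_assoc] using (hφx α).2

theorem theorem10p2 (d : ℕ) (hd : 2 ≤ d) {M : Type*} [MetricSpace M]
    [ChartedSpace (LeviCivitaPhase.Model d) M]
    [IsManifold 𝓘(ℝ, LeviCivitaPhase.Model d) ∞ M]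
    [RiemannianBundle (fun x : M => TangentSpace 𝓘(ℝ, LeviCivitaPhase.Model d) x)]
    [IsContMDiffRiemannianBundle 𝓘(ℝ, LeviCivitaPhase.Model d) ∞ (LeviCivitaPhase.Model d)
      (fun x : M => TangentSpace 𝓘(ℝ, LeviCivitaPhase.Model d) x)]
    [IsRiemannianManifold 𝓘(ℝ, LeviCivitaPhase.Model d) M]
    [CompactSpace M] [ConnectedSpace M]
    (Φ : ℝ → LeviCivitaPhase.CotangentBundle d M → LeviCivitaPhase.CotangentBundle d M)
    (hΦ : LeviCivitaPhase.IsCogeodesicFlow Φ)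
    (ε : ℝ) (hε : 0 < ε)
    (φ : ℝ → M → LeviCivitaPhase.CotangentBundle d M → ℂ)
    (hφ : LeviCivitaPhase.IsLeviCivitaPhase Φ ε φ)
    (t : ℝ) (y : M) (η : LeviCivitaPhase.Cotangent d y) (hη : η ≠ 0)
    (e e' : OpenPartialHomeomorph M (LeviCivitaPhase.Model d))
    (he : e ∈ IsManifold.maximalAtlas 𝓘(ℝ, LeviCivitaPhase.Model d) ∞ M)
    (he' : e' ∈ IsManifold.maximalAtlas 𝓘(ℝ, LeviCivitaPhase.Model d) ∞ M)
    (hx : (Φ t ⟨y, η⟩).proj ∈ e.source) (hy : y ∈ e'.source) (α μ : Fin d) :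
    (∀ β : Fin d,
      LeviCivitaPhase.EtaDifferentiableAt e' (LeviCivitaPhase.xStar e Φ t y β) μ η ∧
      LeviCivitaPhase.EtaDifferentiableAt e' (LeviCivitaPhase.xiStar e Φ t y β) μ η) ∧
    LeviCivitaPhase.EtaDifferentiableAt e'
      (LeviCivitaPhase.phiX e φ t y α (e (Φ t ⟨y, η⟩).proj)) μ η ∧
    LeviCivitaPhase.etaD e'
        (LeviCivitaPhase.phiX e φ t y α (e (Φ t ⟨y, η⟩).proj)) μ η =
      ∑ β, (LeviCivitaPhase.gLow e (e (Φ t ⟨y, η⟩).proj) α β : ℂ) *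
        ((LeviCivitaPhase.p e e' Φ t y η β μ : ℂ)
          - Complex.I * ε * LeviCivitaPhase.ham (⟨y, η⟩ : LeviCivitaPhase.CotangentBundle d M)
            * (LeviCivitaPhase.q e e' Φ t y η β μ : ℂ)) := by
  obtain ⟨hdiff, hφx⟩ := theorem10p2_general
    (fun p hp => (FiberBundle.continuous_proj _ _).comp (hΦ p hp).1.1)
    (fun p hp => congrArg _ (hΦ p hp).2)
    hε.ne' hφ hη (LeviCivitaPhase.coordCovec e' y μ) he hx α
  exact ⟨hdiff, hφx.lineDifferentiableAt, hφx.lineDeriv⟩
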